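/- All tensor products of C$^*$-algebras are minimal, all C$^*$-algebras are unital, and $[X]$ denotes the closed linear span of $X$. Hilbert modules are right Hilbert modules with inner product linear in the second variable; for a Hilbert $A$-module $E$, $\mathcal L(E)$ is the algebra of adjointable operators and $E\otimes C$ is the exterior tensor product, a Hilbert $A\otimes C$-module. Let $G=(C(G),\Delta)$ be a compact quantum group: $C(G)$ is a unital C$^*$-algebra and $\Delta:C(G)\to C(G)\otimes C(G)$ is a coassociative unital $*$-homomorphism with $[\Delta(C(G))(1\otimes C(G))]=[\Delta(C(G))(C(G)\otimes 1)]=C(G)\otimes C(G)$. Let $(A,\alpha)$ be a $G$-C$^*$-algebra: $A$ is a unital C$^*$-algebra and $\alpha:A\to A\otimes C(G)$ is a unital $*$-homomorphism with $(\alpha\otimes\mathrm{id})\alpha=(\mathrm{id}\otimes\Delta)\alpha$ and $[\alpha(A)(1\otimes C(G))]=A\otimes C(G)$. Let $(E,\phi,\lambda)$ be a $G$-equivariant C$^*$-correspondence over $(A,\alpha)$: $E$ is a finitely generated projective Hilbert $A$-module, $\phi:A\to\mathcal L(E)$ is a unital $*$-homomorphism, and $\lambda:E\to E\otimes C(G)$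 is a linear map such that, for all $\xi,\eta\in E$ and $a\in A$, $$\lambda(\xi a)=\lambda(\xi)\alpha(a),\qquad \langle\lambda(\xi),\lambda(\eta)\rangle=\alpha(\langle\xi,\eta\rangle),\qquad \lambda(\phi(a)\xi)=(\phi\otimes\mathrm{id})(\alpha(a))\,\lambda(\xi),$$ $(\lambda\otimes\mathrm{id})\lambda=(\mathrm{id}\otimes\Delta)\lambda$, and $[\lambda(E)(1\otimes C(G))]=E\otimes C(G)$. A representation of $(E,\phi)$ on a unital C$^*$-algebra $B$ is a pair $(t,\pi)$ of a linear map $t:E\to B$ and a unital $*$-homomorphism $\pi:A\to B$ with $t(\xi)^*t(\eta)=\pi(\langle\xi,\eta\rangle)$ and $t(\phi(a)\xi)=\pi(a)t(\xi)$. It is covariant if $\psi_t(\phi(a))=\pi(a)$ whenever $ab=0$ for all $b\in\ker\phi$, where $\psi_t:\mathcal K(E)=\mathcal L(E)\to B$ is the $*$-homomorphism with $\psi_t(\theta_{\xi,\eta})=t(\xi)t(\eta)^*$, $\theta_{\xi,\eta}(\zeta)=\xi\langle\eta,\zeta\rangle$. Let $\mathcal O_E$, with universal covariant representation $(k_E,k_A)$,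 be the Pimsner algebra of $(E,\phi)$: for every covariant representation $(t,\pi)$ on a unital C$^*$-algebra $B$ there is a unique unital $*$-homomorphism $\rho:\mathcal O_E\to B$ with $\rho\circ k_E=t$ and $\rho\circ k_A=\pi$. For $z\in\mathbb T$ let $\gamma_z:\mathcal O_E\to\mathcal O_E$ be the unital $*$-homomorphism with $\gamma_z(k_E(\xi))=z\,k_E(\xi)$ and $\gamma_z(k_A(a))=k_A(a)$ (the gauge action). Let $\omega:\mathcal O_E\to\mathcal O_E\otimes C(G)$ be the induced action, i.e. the unital $*$-homomorphism with $$\omega\circ k_E=(k_E\otimes\mathrm{id})\circ\lambda,\qquad \omega\circ k_A=(k_A\otimes\mathrm{id})\circ\alpha.$$ Then for every $z\in\mathbb T$, $$(\gamma_z\otimes\mathrm{id}_{C(G)})\circ\omega=\omega\circ\gamma_z .$$ -/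

import Mathlib

open scoped TensorProduct InnerProductSpace
open UniformSpace

universe u

noncomputable section

/-- A (unital) representation of a unital C⋆-algebra on a Hilbert space. -/
structure HilbertRep (A : Type u) [CStarAlgebra A] where
  H : Type u
  [normed : NormedAddCommGroup H]
  [inner : InnerProductSpace ℂ H]
  [complete : CompleteSpace H]
  π : A →⋆ₐ[ℂ] (H →L[ℂ] H)

attribute [instance] HilbertRep.normed HilbertRep.inner HilbertRep.complete

namespace HilbertRep

variable {A B C : Type u} [CStarAlgebra A] [CStarAlgebra B] [CStarAlgebra C]

/-- The zero representation. -/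
def zero (A : Type u) [CStarAlgebra A] : HilbertRep A where
  H := PUnit
  π :=
    { toFun := fun _ => 0
      map_one' := Subsingleton.elim _ _
      map_mul' := fun _ _ => Subsingleton.elim _ _
      map_zero' := Subsingleton.elim _ _
      map_add' := fun _ _ => Subsingleton.elim _ _
      commutes' := fun _ => Subsingleton.elim _ _
      map_star' := fun _ => Subsingleton.elim _ _ }

instance : Nonempty (HilbertRep A) := ⟨zero A⟩

/-- The restriction of a representation along a `⋆`-homomorphism. -/
def pull (S : HilbertRep B) (f : A →⋆ₐ[ℂ] B) : HilbertRep A where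
  H := S.H
  π := S.π.comp f

/-- The representation `π ⊗ ρ` of the algebraic tensor product on the inner product space
`H ⊗ K` (whose completion is the Hilbert space tensor product). -/
def tensor (R : HilbertRep A) (S : HilbertRep B) :
    (A ⊗[ℂ] B) →ₐ[ℂ] ((R.H ⊗[ℂ] S.H) →L[ℂ] (R.H ⊗[ℂ] S.H)) :=
  Algebra.TensorProduct.algHomOfLinearMapTensorProduct
    (TensorProduct.lift (LinearMap.mk₂ ℂ (fun a b => TensorProduct.mapL (R.π a) (S.π b))
      (fun a a' b => by rw [map_add, TensorProduct.mapL_add_left])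
      (fun c a b => by rw [map_smul, TensorProduct.mapL_smul_left])
      (fun a b b' => by rw [map_add, TensorProduct.mapL_add_right])
      (fun c a b => by rw [map_smul, TensorProduct.mapL_smul_right])))
    (fun a a' b b' => by simp [TensorProduct.mapL_mul])
    (by ext x; simp)

@[simp] theorem tensor_tmul (R : HilbertRep A) (S : HilbertRep B) (a : A) (b : B) :
    R.tensor S (a ⊗ₜ b) = TensorProduct.mapL (R.π a) (S.π b) := rfl

theorem inner_π (R : HilbertRep A) (a : A) (x y : R.H) :
    ⟪R.π a x, y⟫_ℂ = ⟪x, R.π (star a) y⟫_ℂ := by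
  rw [map_star, ContinuousLinearMap.star_eq_adjoint, ContinuousLinearMap.adjoint_inner_right]

theorem inner_tensor (R : HilbertRep A) (S : HilbertRep B) (x : A ⊗[ℂ] B)
    (v w : R.H ⊗[ℂ] S.H) :
    ⟪R.tensor S x v, w⟫_ℂ = ⟪v, R.tensor S (star x) w⟫_ℂ := by
  induction x with
  | zero => simp
  | add x y hx hy => simp [inner_add_left, inner_add_right, hx, hy]
  | tmul a b =>
    induction v with
    | zero => simp
    | add x y hx hy => simp only [map_add, inner_add_left, hx, hy]
    | tmul h k =>
      induction w with
      | zero => simp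
      | add x y hx hy => simp only [map_add, inner_add_right, hx, hy]
      | tmul h' k' => simp [inner_π]

theorem norm_π_le (R : HilbertRep A) (a : A) : ‖R.π a‖ ≤ ‖a‖ :=
  NonUnitalStarAlgHom.norm_apply_le R.π a

theorem tensor_bound (x : A ⊗[ℂ] B) :
    ∃ M : ℝ, ∀ (R : HilbertRep A) (S : HilbertRep B), ‖R.tensor S x‖ ≤ M := by
  induction x with
  | zero => exact ⟨0, fun R S => by rw [map_zero]; exact ContinuousLinearMap.opNorm_zero.le⟩
  | add x y hx hy =>
    obtain ⟨M, hM⟩ := hx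
    obtain ⟨N, hN⟩ := hy
    refine ⟨M + N, fun R S => ?_⟩
    rw [map_add]
    have h := (R.tensor S x).opNorm_add_le (R.tensor S y)
    linarith [hM R S, hN R S]
  | tmul a b =>
    refine ⟨‖a‖ * ‖b‖, fun R S => ?_⟩
    rw [tensor_tmul]
    refine (TensorProduct.norm_mapL_le _ _).trans ?_
    gcongr
    · exact norm_π_le R a
    · exact norm_π_le S b

theorem norm_tensor_star_mul (R : HilbertRep A) (S : HilbertRep B) (x : A ⊗[ℂ] B) :
    ‖R.tensor S x‖ * ‖R.tensor S x‖ ≤ ‖R.tensor S (star x * x)‖ := by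
  set T := R.tensor S x with hT
  have h : ‖T‖ ≤ √‖R.tensor S (star x * x)‖ := by
    refine T.opNorm_le_bound (Real.sqrt_nonneg _) fun v => ?_
    refine le_of_sq_le_sq ?_ (by positivity)
    rw [mul_pow, Real.sq_sqrt (ContinuousLinearMap.opNorm_nonneg _), ← inner_self_eq_norm_sq (𝕜 := ℂ)]
    rw [hT, inner_tensor, ← mul_apply_eq_comp, ← map_mul]
    have h2 : ‖⟪v, R.tensor S (star x * x) v⟫_ℂ‖ ≤ ‖v‖ * ‖R.tensor S (star x * x) v‖ :=
      norm_inner_le_norm v _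
    refine (RCLike.re_le_norm _).trans (h2.trans ?_)
    rw [sq]
    have := (R.tensor S (star x * x)).le_opNorm v
    nlinarith [norm_nonneg v]
  calc ‖T‖ * ‖T‖ ≤ √‖R.tensor S (star x * x)‖ * √‖R.tensor S (star x * x)‖ := by gcongr
    _ = _ := Real.mul_self_sqrt (ContinuousLinearMap.opNorm_nonneg _)

theorem norm_tensor_star (R : HilbertRep A) (S : HilbertRep B) (x : A ⊗[ℂ] B) :
    ‖R.tensor S (star x)‖ ≤ ‖R.tensor S x‖ := by
  rcases (R.tensor S (star x)).opNorm_nonneg.eq_or_lt with h | h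
  · rw [← h]; exact ContinuousLinearMap.opNorm_nonneg _
  · refine le_of_mul_le_mul_right ((norm_tensor_star_mul R S (star x)).trans ?_) h
    rw [star_star, map_mul]
    exact ContinuousLinearMap.opNorm_comp_le _ _

end HilbertRep

section MinNorm

variable {A B : Type u} [CStarAlgebra A] [CStarAlgebra B]

/-- The minimal (spatial) C⋆-norm on the algebraic tensor product: the supremum of the operator
norms of `(π ⊗ ρ)(x)` over all representations `π` of `A` and `ρ` of `B` on Hilbert spaces. -/
def minNorm (x : A ⊗[ℂ] B) : ℝ :=
  ⨆ p : HilbertRep A × HilbertRep B, ‖p.1.tensor p.2 x‖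

theorem norm_tensor_le (R : HilbertRep A) (S : HilbertRep B) (x : A ⊗[ℂ] B) :
    ‖R.tensor S x‖ ≤ minNorm x := by
  obtain ⟨M, hM⟩ := HilbertRep.tensor_bound x
  exact le_ciSup (f := fun p : HilbertRep A × HilbertRep B => ‖p.1.tensor p.2 x‖)
    ⟨M, by rintro _ ⟨p, rfl⟩; exact hM p.1 p.2⟩ (R, S)

theorem minNorm_le {x : A ⊗[ℂ] B} {M : ℝ}
    (h : ∀ (R : HilbertRep A) (S : HilbertRep B), ‖R.tensor S x‖ ≤ M) : minNorm x ≤ M :=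
  ciSup_le fun p => h p.1 p.2

theorem minNorm_nonneg (x : A ⊗[ℂ] B) : 0 ≤ minNorm x :=
  (ContinuousLinearMap.opNorm_nonneg _).trans (norm_tensor_le (HilbertRep.zero A) (HilbertRep.zero B) x)

theorem minNorm_smul_le (c : ℂ) (x : A ⊗[ℂ] B) : minNorm (c • x) ≤ ‖c‖ * minNorm x :=
  minNorm_le fun R S => by
    rw [map_smul]
    refine (ContinuousLinearMap.opNorm_smul_le _ _).trans ?_
    gcongr
    exact norm_tensor_le R S x

theorem minNorm_mul_le (x y : A ⊗[ℂ] B) : minNorm (x * y) ≤ minNorm x * minNorm y :=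
  minNorm_le fun R S => by
    rw [map_mul]
    refine (ContinuousLinearMap.opNorm_comp_le _ _).trans ?_
    gcongr
    · exact minNorm_nonneg x
    · exact norm_tensor_le R S x
    · exact norm_tensor_le R S y

theorem minNorm_star_mul (x : A ⊗[ℂ] B) : minNorm x * minNorm x ≤ minNorm (star x * x) := by
  have h : minNorm x ≤ √(minNorm (star x * x)) := minNorm_le fun R S => by
    refine Real.le_sqrt_of_sq_le ?_
    rw [sq]
    exact (HilbertRep.norm_tensor_star_mul R S x).trans (norm_tensor_le R S _)
  calc minNorm x * minNorm x ≤ √(minNorm (star x * x)) * √(minNorm (star x * x)) := by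
        gcongr
        exact minNorm_nonneg x
    _ = _ := Real.mul_self_sqrt (minNorm_nonneg _)

theorem minNorm_star (x : A ⊗[ℂ] B) : minNorm (star x) = minNorm x := by
  have h : ∀ y : A ⊗[ℂ] B, minNorm (star y) ≤ minNorm y := fun y => minNorm_le fun R S =>
    (HilbertRep.norm_tensor_star R S y).trans (norm_tensor_le R S y)
  exact le_antisymm (h x) (by simpa using h (star x))

theorem minNorm_zero : minNorm (0 : A ⊗[ℂ] B) = 0 :=
  le_antisymm (minNorm_le fun R S => by rw [map_zero]; exact ContinuousLinearMap.opNorm_zero.le) (minNorm_nonneg _)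

theorem minNorm_neg (x : A ⊗[ℂ] B) : minNorm (-x) = minNorm x := by
  simp only [minNorm, map_neg, ContinuousLinearMap.opNorm_neg]

theorem minNorm_add_le (x y : A ⊗[ℂ] B) : minNorm (x + y) ≤ minNorm x + minNorm y :=
  minNorm_le fun R S => by
    rw [map_add]
    have h := (R.tensor S x).opNorm_add_le (R.tensor S y)
    linarith [norm_tensor_le R S x, norm_tensor_le R S y]

variable (A B) in
/-- The algebraic tensor product, as a type carrying the minimal C⋆-norm. -/
def PreMinTensor : Type u := A ⊗[ℂ] B

namespace PreMinTensor

instance : Ring (PreMinTensor A B) := inferInstanceAs (Ring (A ⊗[ℂ] B))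
instance : Algebra ℂ (PreMinTensor A B) := inferInstanceAs (Algebra ℂ (A ⊗[ℂ] B))
instance : StarRing (PreMinTensor A B) := inferInstanceAs (StarRing (A ⊗[ℂ] B))
instance : StarModule ℂ (PreMinTensor A B) := inferInstanceAs (StarModule ℂ (A ⊗[ℂ] B))

variable (A B) in
def seminorm : AddGroupSeminorm (PreMinTensor A B) where
  toFun x := minNorm (A := A) (B := B) x
  map_zero' := minNorm_zero
  add_le' := minNorm_add_le (A := A) (B := B)
  neg' := minNorm_neg (A := A) (B := B)

instance : SeminormedRing (PreMinTensor A B) where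
  toRing := inferInstance
  __ := (seminorm A B).toSeminormedAddCommGroup
  norm_mul_le x y := minNorm_mul_le (A := A) (B := B) x y

theorem norm_def (x : PreMinTensor A B) : ‖x‖ = minNorm (A := A) (B := B) x := rfl

instance : NormedAlgebra ℂ (PreMinTensor A B) where
  norm_smul_le c x := minNorm_smul_le (A := A) (B := B) c x

theorem norm_star (x : PreMinTensor A B) : ‖star x‖ = ‖x‖ := minNorm_star (A := A) (B := B) x

theorem norm_star_mul (x : PreMinTensor A B) : ‖x‖ * ‖x‖ ≤ ‖star x * x‖ :=
  minNorm_star_mul (A := A) (B := B) x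

instance : NormedStarGroup (PreMinTensor A B) where
  norm_star_le x := (norm_star x).le

end PreMinTensor

variable (A B) in
/-- The minimal tensor product of two unital C⋆-algebras. -/
def MinTensor : Type u := Completion (PreMinTensor A B)

namespace MinTensor

instance : NormedRing (MinTensor A B) :=
  inferInstanceAs (NormedRing (Completion (PreMinTensor A B)))
instance : CompleteSpace (MinTensor A B) :=
  inferInstanceAs (CompleteSpace (Completion (PreMinTensor A B)))
instance : Algebra ℂ (MinTensor A B) := inferInstanceAs (Algebra ℂ (Completion (PreMinTensor A B)))
instance : NormedAlgebra ℂ (MinTensor A B) where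
  norm_smul_le :=
    (inferInstance : NormedSpace ℂ (Completion (PreMinTensor A B))).norm_smul_le

variable (A B) in
/-- The canonical map from the algebraic tensor product to the minimal tensor product. -/
def ι : A ⊗[ℂ] B →ₐ[ℂ] MinTensor A B where
  toFun x := ((show PreMinTensor A B from x) : Completion (PreMinTensor A B))
  map_one' := rfl
  map_mul' x y := Completion.coe_mul (α := PreMinTensor A B) x y
  map_zero' := rfl
  map_add' x y := Completion.coe_add (α := PreMinTensor A B) x y
  commutes' _ := rfl

theorem norm_ι (x : A ⊗[ℂ] B) : ‖ι A B x‖ = minNorm x :=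
  Completion.norm_coe (E := PreMinTensor A B) x

theorem denseRange_ι : DenseRange (ι A B) := Completion.denseRange_coe (α := PreMinTensor A B)

theorem induction {p : MinTensor A B → Prop} (hc : IsClosed {x | p x})
    (h : ∀ x, p (ι A B x)) (x : MinTensor A B) : p x :=
  denseRange_ι.induction_on x hc h

theorem induction₂ {p : MinTensor A B → MinTensor A B → Prop}
    (hc : IsClosed {x : MinTensor A B × MinTensor A B | p x.1 x.2})
    (h : ∀ x y, p (ι A B x) (ι A B y)) (x y : MinTensor A B) : p x y :=
  isClosed_property2 denseRange_ι hc h x y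

instance : Star (MinTensor A B) where
  star := Completion.map (α := PreMinTensor A B) star

theorem star_ι (x : A ⊗[ℂ] B) : star (ι A B x) = ι A B (star x) :=
  Completion.map_coe (α := PreMinTensor A B) (f := star)
    (starₗᵢ ℂ : PreMinTensor A B ≃ₗᵢ⋆[ℂ] PreMinTensor A B).isometry.uniformContinuous x

theorem continuous_star' : Continuous (star : MinTensor A B → MinTensor A B) :=
  Completion.continuous_map

instance : StarRing (MinTensor A B) where
  star_involutive := induction
    (isClosed_eq (continuous_star'.comp continuous_star') continuous_id)
    fun x => by simp only [star_ι, star_star]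
  star_mul := induction₂
    (isClosed_eq (continuous_star'.comp (continuous_fst.mul continuous_snd))
      ((continuous_star'.comp continuous_snd).mul (continuous_star'.comp continuous_fst)))
    fun x y => by simp only [star_ι, ← map_mul, star_mul]
  star_add := induction₂
    (isClosed_eq (continuous_star'.comp (continuous_fst.add continuous_snd))
      ((continuous_star'.comp continuous_fst).add (continuous_star'.comp continuous_snd)))
    fun x y => by simp only [star_ι, ← map_add, star_add]

instance : CStarAlgebra (MinTensor A B) where
  norm_mul_self_le := induction
    (isClosed_le (continuous_norm.mul continuous_norm)
      (continuous_norm.comp (continuous_star'.mul continuous_id)))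
    fun x => by
      simp only [star_ι, ← map_mul, norm_ι]
      exact minNorm_star_mul x
  star_smul c := induction
    (isClosed_eq (continuous_star'.comp (continuous_const_smul c))
      (continuous_star'.const_smul (star c)))
    fun x => by simp only [star_ι, ← map_smul, star_smul]

/-- The elementary tensor `a ⊗ b`. -/
def tmul (a : A) (b : B) : MinTensor A B := ι A B (a ⊗ₜ b)

variable {A' B' : Type u} [CStarAlgebra A'] [CStarAlgebra B']

theorem minNorm_map_le (f : A →⋆ₐ[ℂ] A') (g : B →⋆ₐ[ℂ] B') (x : A ⊗[ℂ] B) :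
    minNorm (Algebra.TensorProduct.map f.toAlgHom g.toAlgHom x) ≤ minNorm x :=
  minNorm_le fun R S => by
    have : R.tensor S (Algebra.TensorProduct.map f.toAlgHom g.toAlgHom x)
        = (R.pull f).tensor (S.pull g) x := by
      induction x with
      | zero => rw [map_zero, map_zero]; exact (map_zero _).symm
      | add x y hx hy => rw [map_add, map_add, hx, hy]; exact (map_add _ _ _).symm
      | tmul a b => rfl
    rw [this]
    exact norm_tensor_le _ _ x

/-- The continuous extension to `A ⊗ B` of a linear map on the algebraic tensor product that is
bounded for the minimal norm. -/
def ext {F : Type*} [NormedAddCommGroup F] [NormedSpace ℂ F] [CompleteSpace F]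
    (f : A ⊗[ℂ] B →ₗ[ℂ] F) : MinTensor A B →L[ℂ] F :=
  f.extendOfNorm (ι A B).toLinearMap

theorem ext_ι {F : Type*} [NormedAddCommGroup F] [NormedSpace ℂ F] [CompleteSpace F]
    (f : A ⊗[ℂ] B →ₗ[ℂ] F) {c : ℝ} (h : ∀ x, ‖f x‖ ≤ c * minNorm x) (x : A ⊗[ℂ] B) :
    ext f (ι A B x) = f x :=
  LinearMap.extendOfNorm_eq (e := (ι A B).toLinearMap) denseRange_ι
    ⟨c, fun x => (h x).trans_eq (congrArg (c * ·) (norm_ι x).symm)⟩ x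

/-- The linear map underlying `f ⊗ g`. -/
def mapL (f : A →⋆ₐ[ℂ] A') (g : B →⋆ₐ[ℂ] B') : MinTensor A B →L[ℂ] MinTensor A' B' :=
  ext ((ι A' B').comp (Algebra.TensorProduct.map f.toAlgHom g.toAlgHom)).toLinearMap

theorem mapL_ι (f : A →⋆ₐ[ℂ] A') (g : B →⋆ₐ[ℂ] B') (x : A ⊗[ℂ] B) :
    mapL f g (ι A B x) = ι A' B' (Algebra.TensorProduct.map f.toAlgHom g.toAlgHom x) :=
  ext_ι (c := 1) _ (fun y => by
    rw [one_mul]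
    exact (norm_ι _).trans_le (minNorm_map_le f g y)) x

/-- The unital `⋆`-homomorphism `f ⊗ g : A ⊗ B → A' ⊗ B'`. -/
def map (f : A →⋆ₐ[ℂ] A') (g : B →⋆ₐ[ℂ] B') : MinTensor A B →⋆ₐ[ℂ] MinTensor A' B' where
  toFun := mapL f g
  map_one' := by rw [← map_one (ι A B), mapL_ι, map_one, map_one]
  map_mul' := induction₂ (isClosed_eq (by fun_prop) (by fun_prop))
    fun x y => by simp only [← map_mul, mapL_ι]
  map_zero' := map_zero _
  map_add' := map_add _
  commutes' c := by
    rw [← (ι A B).commutes, mapL_ι, AlgHom.commutes, AlgHom.commutes]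
  map_star' := induction (isClosed_eq (by fun_prop) (by fun_prop))
    fun x => by
      rw [star_ι, mapL_ι, mapL_ι, star_ι]
      congr 1
      induction x with
      | zero => simp
      | add x y hx hy => simp only [star_add, map_add, hx, hy]
      | tmul a b => simp [map_star]

theorem map_tmul (f : A →⋆ₐ[ℂ] A') (g : B →⋆ₐ[ℂ] B') (a : A) (b : B) :
    map f g (tmul a b) = tmul (f a) (g b) := mapL_ι f g (a ⊗ₜ b)

end MinTensor

end MinNorm

/-- A right Hilbert module over a unital C⋆-algebra `A`: a complex Banach space with a right
`A`-action and an `A`-valued inner product, linear in the second variable, whose norm is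
`‖x‖ = ‖⟨x, x⟩‖ ^ (1 / 2)`. (Mathlib's `CStarModule` is about left modules.) -/
class HilbertModule (A : Type u) (E : Type u) [CStarAlgebra A] [NormedAddCommGroup E]
    [NormedSpace ℂ E] [CompleteSpace E] [Module Aᵐᵒᵖ E] where
  ip : E → E → A
  ip_add_right : ∀ x y z, ip x (y + z) = ip x y + ip x z
  ip_smul_right : ∀ (c : ℂ) x y, ip x (c • y) = c • ip x y
  ip_op_smul_right : ∀ (a : A) x y, ip x (MulOpposite.op a • y) = ip x y * a
  star_ip : ∀ x y, star (ip x y) = ip y x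
  ip_self_nonneg : ∀ x, ∃ a, ip x x = star a * a
  norm_sq : ∀ x, ‖x‖ ^ 2 = ‖ip x x‖

section Hilbert

variable (A : Type u) {E : Type u} [CStarAlgebra A] [NormedAddCommGroup E]
    [NormedSpace ℂ E] [CompleteSpace E] [Module Aᵐᵒᵖ E] [HilbertModule A E]

/-- The `A`-valued inner product `⟨x, y⟩`. -/
def hip (x y : E) : A := HilbertModule.ip x y

variable {A}

theorem hip_add_right (x y z : E) : hip A x (y + z) = hip A x y + hip A x z :=
  HilbertModule.ip_add_right x y z

theorem hip_smul_right (c : ℂ) (x y : E) : hip A x (c • y) = c • hip A x y :=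
  HilbertModule.ip_smul_right c x y

theorem hip_op_smul_right (a : A) (x y : E) :
    hip A x (MulOpposite.op a • y) = hip A x y * a := HilbertModule.ip_op_smul_right a x y

theorem star_hip (x y : E) : star (hip A x y) = hip A y x := HilbertModule.star_ip x y

theorem hip_add_left (x y z : E) : hip A (x + y) z = hip A x z + hip A y z := by
  rw [← star_hip, hip_add_right, star_add, star_hip, star_hip]

theorem hip_smul_left (c : ℂ) (x y : E) : hip A (c • x) y = star c • hip A x y := by
  rw [← star_hip, hip_smul_right, star_smul, star_hip]

theorem hip_op_smul_left (a : A) (x y : E) :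
    hip A (MulOpposite.op a • x) y = star a * hip A x y := by
  rw [← star_hip, hip_op_smul_right, star_mul, star_hip]

variable (A E) in
/-- The inner product as a sesquilinear map. -/
def hipₛₗ : E →ₗ⋆[ℂ] E →ₗ[ℂ] A :=
  LinearMap.mk₂'ₛₗ (starRingEnd ℂ) (RingHom.id ℂ) (hip A) hip_add_left hip_smul_left
    hip_add_right hip_smul_right

theorem hip_self_eq_zero {x : E} (h : hip A x x = 0) : x = 0 := by
  have h1 := HilbertModule.norm_sq (A := A) x
  rw [show HilbertModule.ip x x = hip A x x from rfl, h, norm_zero] at h1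
  simpa using h1

theorem ext_hip {x y : E} (h : ∀ z, hip A z x = hip A z y) : x = y := by
  rw [← sub_eq_zero]
  refine hip_self_eq_zero (A := A) ?_
  have := map_sub (hipₛₗ A E (x - y)) x y
  exact this.trans (sub_eq_zero.2 (h _))

end Hilbert

/-- The algebra `𝓛(E)` of adjointable operators on a Hilbert module. -/
structure Adjointable (A E : Type u) [CStarAlgebra A] [NormedAddCommGroup E]
    [NormedSpace ℂ E] [CompleteSpace E] [Module Aᵐᵒᵖ E] [HilbertModule A E] where
  toFun : E → E
  adj : E → E
  hip_adj : ∀ x y, hip A (toFun x) y = hip A x (adj y)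

namespace Adjointable

variable {A E : Type u} [CStarAlgebra A] [NormedAddCommGroup E]
    [NormedSpace ℂ E] [CompleteSpace E] [Module Aᵐᵒᵖ E] [HilbertModule A E]

instance : CoeFun (Adjointable A E) fun _ => E → E := ⟨toFun⟩

theorem adj_hip (T : Adjointable A E) (x y : E) : hip A (T.adj x) y = hip A x (T y) := by
  rw [← star_hip, ← T.hip_adj, star_hip]

@[ext] theorem ext {S T : Adjointable A E} (h : ∀ x, S x = T x) : S = T := by
  have h1 : S.toFun = T.toFun := funext h
  have h2 : S.adj = T.adj := funext fun y => ext_hip (A := A) fun z => by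
    rw [← S.hip_adj, ← T.hip_adj, h1]
  cases S; cases T; simp_all

theorem map_add' (T : Adjointable A E) (x y : E) : T (x + y) = T x + T y :=
  ext_hip (A := A) fun z => by simp only [hip_add_right, ← T.adj_hip]

theorem map_smul' (T : Adjointable A E) (c : ℂ) (x : E) : T (c • x) = c • T x :=
  ext_hip (A := A) fun z => by simp only [hip_smul_right, ← T.adj_hip]

/-- The underlying linear map of an adjointable operator. -/
def lin (T : Adjointable A E) : E →ₗ[ℂ] E where
  toFun := T
  map_add' := T.map_add'
  map_smul' := T.map_smul'

instance : Zero (Adjointable A E) := ⟨⟨0, 0, fun x y => by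
  have h1 := hip_smul_left (A := A) 0 x y
  have h2 := hip_smul_right (A := A) 0 x y
  simp only [zero_smul, star_zero] at h1 h2
  exact h1.trans h2.symm⟩⟩
instance : One (Adjointable A E) := ⟨⟨id, id, fun _ _ => rfl⟩⟩
instance : Add (Adjointable A E) := ⟨fun S T => ⟨fun x => S x + T x, fun x => S.adj x + T.adj x,
  fun x y => by rw [hip_add_left, hip_add_right, S.hip_adj, T.hip_adj]⟩⟩
instance : SMul ℂ (Adjointable A E) := ⟨fun c T => ⟨fun x => c • T x, fun x => star c • T.adj x,
  fun x y => by rw [hip_smul_left, hip_smul_right, T.hip_adj]⟩⟩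
instance : Neg (Adjointable A E) := ⟨fun T => (-1 : ℂ) • T⟩
instance : Mul (Adjointable A E) := ⟨fun S T => ⟨fun x => S (T x), fun x => T.adj (S.adj x),
  fun x y => by rw [S.hip_adj, T.hip_adj]⟩⟩
instance : Star (Adjointable A E) := ⟨fun T => ⟨T.adj, T, T.adj_hip⟩⟩

theorem zero_apply (x : E) : (0 : Adjointable A E) x = 0 := rfl
theorem one_apply (x : E) : (1 : Adjointable A E) x = x := rfl
theorem add_apply (S T : Adjointable A E) (x : E) : (S + T) x = S x + T x := rfl
theorem smul_apply (c : ℂ) (T : Adjointable A E) (x : E) : (c • T) x = c • T x := rfl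
theorem neg_apply (T : Adjointable A E) (x : E) : (-T) x = - T x := by
  change (-1 : ℂ) • T x = _
  simp
theorem mul_apply (S T : Adjointable A E) (x : E) : (S * T) x = S (T x) := rfl
theorem star_apply (T : Adjointable A E) (x : E) : (star T) x = T.adj x := rfl

instance : AddCommGroup (Adjointable A E) where
  add_assoc _ _ _ := ext fun _ => add_assoc _ _ _
  zero_add _ := ext fun _ => zero_add _
  add_zero _ := ext fun _ => add_zero _
  add_comm _ _ := ext fun _ => add_comm _ _
  neg_add_cancel T := ext fun x => by rw [add_apply, neg_apply, neg_add_cancel, zero_apply]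
  nsmul := nsmulRec
  zsmul := zsmulRec

instance : Ring (Adjointable A E) where
  left_distrib R _ _ := ext fun x => R.map_add' _ _
  right_distrib R S T := ext fun _ => rfl
  zero_mul _ := ext fun _ => rfl
  mul_zero T := ext fun x => by
    have := T.map_smul' 0 0
    simpa [mul_apply, zero_apply] using this
  mul_assoc _ _ _ := ext fun _ => rfl
  one_mul _ := ext fun _ => rfl
  mul_one _ := ext fun _ => rfl
  zsmul := zsmulRec
  neg_add_cancel := neg_add_cancel

instance : Module ℂ (Adjointable A E) where
  one_smul _ := ext fun _ => one_smul _ _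
  mul_smul _ _ _ := ext fun _ => mul_smul _ _ _
  smul_zero _ := ext fun _ => smul_zero _
  smul_add _ _ _ := ext fun _ => smul_add _ _ _
  add_smul _ _ _ := ext fun _ => add_smul _ _ _
  zero_smul _ := ext fun _ => zero_smul _ _

instance : Algebra ℂ (Adjointable A E) := Algebra.ofModule
  (fun _ _ _ => ext fun _ => rfl) (fun _ S _ => ext fun _ => S.map_smul' _ _)

instance : StarRing (Adjointable A E) where
  star_involutive _ := rfl
  star_mul _ _ := rfl
  star_add _ _ := rfl

/-- The rank-one operator `θ_{ξ,η} : ζ ↦ ξ ⟨η, ζ⟩`. -/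
def theta (ξ η : E) : Adjointable A E where
  toFun ζ := MulOpposite.op (hip A η ζ) • ξ
  adj ζ := MulOpposite.op (hip A ξ ζ) • η
  hip_adj x y := by rw [hip_op_smul_left, hip_op_smul_right, star_hip]

end Adjointable

section Positivity

variable {A : Type u} [CStarAlgebra A]

theorem exists_negPart {T : A} (hT : IsSelfAdjoint T) :
    ∃ N S : A, star N = N ∧ N = star S * S ∧ N * T * N = -(star (S * N) * (S * N)) ∧
      (N = 0 → ∃ Q, T = star Q * Q) := by
  let _ := CStarAlgebra.spectralOrder A
  have _ := CStarAlgebra.spectralOrderedRing A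
  have hN0 : 0 ≤ T⁻ := CFC.negPart_nonneg T
  obtain ⟨S, hS⟩ := CStarAlgebra.nonneg_iff_eq_star_mul_self.1 hN0
  have hNs : star T⁻ = T⁻ := hN0.isSelfAdjoint
  refine ⟨T⁻, S, hNs, hS, ?_, fun h => ?_⟩
  · have h1 : T⁻ * T = -(T⁻ * T⁻) := by
      nth_rw 2 [← CFC.posPart_sub_negPart T hT]
      rw [mul_sub, CFC.negPart_mul_posPart, zero_sub]
    rw [h1, neg_mul, star_mul, hNs, mul_assoc, mul_assoc, ← mul_assoc (star S), ← hS]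
  · refine CStarAlgebra.nonneg_iff_eq_star_mul_self.1 ?_
    rw [← CFC.posPart_sub_negPart T hT, h, sub_zero]
    exact CFC.posPart_nonneg T

/-- A self-adjoint matrix over a C⋆-algebra that is positive as a quadratic form is of the form
`S⋆ S`. -/
theorem exists_factor {I : Type} [Fintype I] (M : I → I → A)
    (hM : ∀ i j, star (M i j) = M j i)
    (h : ∀ a : I → A, ∃ b, ∑ i, ∑ j, star (a i) * M i j * a j = star b * b) :
    ∃ S : I → I → A, ∀ i j, M i j = ∑ k, star (S k i) * S k j := by
  classical
  let _ := CStarAlgebra.spectralOrder A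
  have _ := CStarAlgebra.spectralOrderedRing A
  let T : CStarMatrix I I A := CStarMatrix.ofMatrix (Matrix.of M)
  have hT : IsSelfAdjoint T := by
    ext i j
    exact hM j i
  obtain ⟨N, S, hNs, hS, hTN, hQ⟩ := exists_negPart hT
  have hmul : ∀ (X Y : CStarMatrix I I A) (i j : I), (X * Y) i j = ∑ k, X i k * Y k j :=
    fun X Y i j => CStarMatrix.mul_apply
  have hstar : ∀ (X : CStarMatrix I I A) (i j : I), (star X) i j = star (X j i) :=
    fun X i j => rfl
  have hSN : S * N = 0 := by
    ext k j
    have h1 : 0 ≤ (N * T * N) j j := by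
      obtain ⟨b, hb⟩ := h fun i => N i j
      have : (N * T * N) j j = star b * b := by
        rw [← hb]
        nth_rw 1 [← hNs]
        simp only [hmul, hstar, Finset.sum_mul]
        exact Finset.sum_comm
      rw [this]
      exact star_mul_self_nonneg b
    rw [hTN] at h1
    have h3 : ∑ i, star ((S * N) i j) * (S * N) i j ≤ 0 := by
      have h2 : (star (S * N) * (S * N)) j j = ∑ i, star ((S * N) i j) * (S * N) i j :=
        hmul _ _ _ _
      rw [← h2]
      exact neg_nonneg.1 h1
    have h4 : ∀ i ∈ Finset.univ, 0 ≤ star ((S * N) i j) * (S * N) i j :=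
      fun i _ => star_mul_self_nonneg _
    have h5 := (Finset.sum_eq_zero_iff_of_nonneg h4).1 (le_antisymm h3 (Finset.sum_nonneg h4)) k
      (Finset.mem_univ k)
    exact (CStarRing.star_mul_self_eq_zero_iff _).1 h5
  have hNN : star N * N = 0 := by
    rw [hNs]
    nth_rw 1 [hS]
    rw [mul_assoc, hSN, mul_zero]
  obtain ⟨Q, hQ⟩ := hQ ((CStarRing.star_mul_self_eq_zero_iff _).1 hNN)
  exact ⟨fun k i => Q k i, fun i j => (congrFun (congrFun hQ i) j).trans (hmul _ _ _ _)⟩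

theorem exists_sum_star_mul {I : Type} [Fintype I] (s : I → A) :
    ∃ b, ∑ i, star (s i) * s i = star b * b := by
  let _ := CStarAlgebra.spectralOrder A
  have _ := CStarAlgebra.spectralOrderedRing A
  exact CStarAlgebra.nonneg_iff_eq_star_mul_self.1
    (Finset.sum_nonneg fun i _ => star_mul_self_nonneg _)

/-- Cauchy-Schwarz in `Aⁿ`. -/
theorem norm_sum_star_mul_le {I : Type} [Fintype I] (s t : I → A) :
    ‖∑ i, star (s i) * t i‖ ≤
      √‖∑ i, star (s i) * s i‖ * √‖∑ i, star (t i) * t i‖ := by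
  let _ := CStarAlgebra.spectralOrder A
  have _ := CStarAlgebra.spectralOrderedRing A
  let x : WithCStarModule A (I → A) := (WithCStarModule.equiv A (I → A)).symm fun i => star (s i)
  let y : WithCStarModule A (I → A) := (WithCStarModule.equiv A (I → A)).symm fun i => star (t i)
  have h := CStarModule.norm_inner_le (A := A) (WithCStarModule A (I → A)) (x := y) (y := x)
  rw [WithCStarModule.pi_norm, WithCStarModule.pi_norm, WithCStarModule.pi_inner, mul_comm] at h
  have e : ∀ u v : A, inner A (star u) (star v) = star v * u := fun u v => by
    change star v * star (star u) = _
    rw [star_star]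
  have e1 : ∑ i, inner A (y i) (x i) = ∑ i, star (s i) * t i :=
    Finset.sum_congr rfl fun i _ => e _ _
  have e2 : ∑ i, inner A (x i) (x i) = ∑ i, star (s i) * s i :=
    Finset.sum_congr rfl fun i _ => e _ _
  have e3 : ∑ i, inner A (y i) (y i) = ∑ i, star (t i) * t i :=
    Finset.sum_congr rfl fun i _ => e _ _
  rwa [e1, e2, e3] at h

/-- The Gram matrix of a finite family in a Hilbert module is of the form `S⋆ S`. -/
theorem exists_gram_factor {E : Type u} [NormedAddCommGroup E] [NormedSpace ℂ E]
    [CompleteSpace E] [Module Aᵐᵒᵖ E] [HilbertModule A E] {I : Type} [Fintype I] (ξ : I → E) :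
    ∃ S : I → I → A, ∀ i j, hip A (ξ i) (ξ j) = ∑ k, star (S k i) * S k j := by
  refine exists_factor _ (fun i j => star_hip _ _) fun a => ?_
  obtain ⟨b, hb⟩ := HilbertModule.ip_self_nonneg (A := A) (∑ i, MulOpposite.op (a i) • ξ i)
  refine ⟨b, ?_⟩
  rw [← hb]
  change _ = hipₛₗ A E _ _
  rw [map_sum, Finset.sum_comm]
  refine Finset.sum_congr rfl fun i _ => ?_
  rw [map_sum, LinearMap.sum_apply]
  refine Finset.sum_congr rfl fun j _ => ?_
  change _ = hip A _ _
  rw [hip_op_smul_left, hip_op_smul_right, mul_assoc]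

end Positivity

section Extension

/-- The continuous extension of a bounded map that is (semi)linear in the first and linear in the
second variable to completions in both variables. -/
def ext₂ {V W V' W' Z : Type*} [AddCommGroup V] [Module ℂ V] [AddCommGroup W] [Module ℂ W]
    [NormedAddCommGroup V'] [NormedSpace ℂ V'] [NormedAddCommGroup W'] [NormedSpace ℂ W']
    [NormedAddCommGroup Z] [NormedSpace ℂ Z] [CompleteSpace Z] {σ : ℂ →+* ℂ}
    (eV : V →ₗ[ℂ] V') (eW : W →ₗ[ℂ] W') (hW : DenseRange eW)
    (f : V →ₛₗ[σ] W →ₗ[ℂ] Z) (hf : ∀ v w, ‖f v w‖ ≤ ‖eV v‖ * ‖eW w‖) :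
    V' →SL[σ] W' →L[ℂ] Z :=
  LinearMap.extendOfNorm
    { toFun := fun v => (f v).extendOfNorm eW
      map_add' := fun v v' => LinearMap.extendOfNorm_unique hW ‖eV (v + v')‖ (hf _) _ (by
        ext w
        simp [LinearMap.extendOfNorm_eq hW ⟨_, hf v⟩, LinearMap.extendOfNorm_eq hW ⟨_, hf v'⟩])
      map_smul' := fun c v => LinearMap.extendOfNorm_unique hW ‖eV (c • v)‖ (hf _) _ (by
        ext w
        simp [LinearMap.extendOfNorm_eq hW ⟨_, hf v⟩]) } eV

theorem ext₂_eq {V W V' W' Z : Type*} [AddCommGroup V] [Module ℂ V] [AddCommGroup W] [Module ℂ W]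
    [NormedAddCommGroup V'] [NormedSpace ℂ V'] [NormedAddCommGroup W'] [NormedSpace ℂ W']
    [NormedAddCommGroup Z] [NormedSpace ℂ Z] [CompleteSpace Z] {σ : ℂ →+* ℂ}
    (eV : V →ₗ[ℂ] V') (eW : W →ₗ[ℂ] W') (hV : DenseRange eV) (hW : DenseRange eW)
    (f : V →ₛₗ[σ] W →ₗ[ℂ] Z) (hf : ∀ v w, ‖f v w‖ ≤ ‖eV v‖ * ‖eW w‖) (v : V) (w : W) :
    ext₂ eV eW hW f hf (eV v) (eW w) = f v w := by
  rw [ext₂, LinearMap.extendOfNorm_eq hV ⟨1, fun v => ?_⟩]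
  · exact LinearMap.extendOfNorm_eq hW ⟨_, hf v⟩ w
  · rw [one_mul]
    exact LinearMap.opNorm_extendOfNorm_le hW (norm_nonneg _) (hf v)

end Extension

section Ext

variable (A E B : Type u) [CStarAlgebra A] [CStarAlgebra B] [NormedAddCommGroup E]
    [NormedSpace ℂ E] [CompleteSpace E] [Module Aᵐᵒᵖ E] [HilbertModule A E]

/-- The `A ⊙ B`-valued form on `E ⊙ B` with `⟨ξ ⊗ b, η ⊗ c⟩ = ⟨ξ, η⟩ ⊗ b⋆ c`. -/
def form : E ⊗[ℂ] B →ₗ⋆[ℂ] E ⊗[ℂ] B →ₗ[ℂ] A ⊗[ℂ] B :=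
  (TensorProduct.homTensorHomMap (RingHom.id ℂ) E B A B).comp
    (TensorProduct.map (hipₛₗ A E) ((LinearMap.mul ℂ B).comp (starLinearEquiv ℂ (A := B)).toLinearMap))

/-- The right action of `A ⊙ B` on `E ⊙ B` with `(ξ ⊗ b) (a ⊗ c) = ξ a ⊗ b c`. -/
def ract : E ⊗[ℂ] B →ₗ[ℂ] A ⊗[ℂ] B →ₗ[ℂ] E ⊗[ℂ] B :=
  (TensorProduct.homTensorHomMap (RingHom.id ℂ) A B E B).comp
    (TensorProduct.map
      (LinearMap.mk₂ ℂ (fun (ξ : E) (a : A) => MulOpposite.op a • ξ)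
        (fun x y a => smul_add _ _ _)
        (fun c x a => ext_hip (A := A) fun z => by simp only [hip_op_smul_right, hip_smul_right,
          smul_mul_assoc])
        (fun x a b => by rw [MulOpposite.op_add, add_smul])
        (fun c a x => ext_hip (A := A) fun z => by simp only [hip_op_smul_right, hip_smul_right,
          mul_smul_comm]))
      (LinearMap.mul ℂ B))

variable {A E B}

@[simp] theorem form_tmul (ξ η : E) (b c : B) :
    form A E B (ξ ⊗ₜ b) (η ⊗ₜ c) = hip A ξ η ⊗ₜ (star b * c) := rfl

@[simp] theorem ract_tmul (ξ : E) (a : A) (b c : B) :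
    ract A E B (ξ ⊗ₜ b) (a ⊗ₜ c) = (MulOpposite.op a • ξ) ⊗ₜ (b * c) := rfl

theorem star_form (v w : E ⊗[ℂ] B) : star (form A E B v w) = form A E B w v := by
  induction v with
  | zero => simp
  | add x y hx hy => simp [hx, hy]
  | tmul ξ b =>
    induction w with
    | zero => simp
    | add x y hx hy => simp only [map_add, star_add, hx, hy, LinearMap.add_apply]
    | tmul η c => simp [star_hip]

theorem form_ract (v w : E ⊗[ℂ] B) (x : A ⊗[ℂ] B) :
    form A E B v (ract A E B w x) = form A E B v w * x := by
  induction v with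
  | zero => simp
  | add y z hy hz => simp [hy, hz, add_mul]
  | tmul ξ b =>
    induction w with
    | zero => simp
    | add y z hy hz => simp only [map_add, hy, hz, LinearMap.add_apply, add_mul]
    | tmul η c =>
      induction x with
      | zero => simp
      | add y z hy hz => simp only [map_add, hy, hz, mul_add]
      | tmul a d => simp [hip_op_smul_right, mul_assoc]

theorem exists_form_factor (v w : E ⊗[ℂ] B) : ∃ (I : Type) (_ : Fintype I) (s t : I → A ⊗[ℂ] B),
    form A E B v v = ∑ i, star (s i) * s i ∧ form A E B v w = ∑ i, star (s i) * t i ∧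
    form A E B w w = ∑ i, star (t i) * t i := by
  obtain ⟨k, ξ, b, rfl⟩ := TensorProduct.exists_sum_tmul_eq v
  obtain ⟨l, η, c, rfl⟩ := TensorProduct.exists_sum_tmul_eq w
  obtain ⟨S, hS⟩ := exists_gram_factor (A := A) (Sum.elim ξ η)
  have key : ∀ (m n : ℕ) (x : Fin m → E) (y : Fin n → E) (p : Fin m → B) (q : Fin n → B)
      (f : Fin m → Fin k ⊕ Fin l) (g : Fin n → Fin k ⊕ Fin l)
      (_ : ∀ i, x i = Sum.elim ξ η (f i)) (_ : ∀ i, y i = Sum.elim ξ η (g i)),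
      form A E B (∑ i, x i ⊗ₜ p i) (∑ j, y j ⊗ₜ q j) =
        ∑ r, star (∑ i, S r (f i) ⊗ₜ[ℂ] p i) * (∑ j, S r (g j) ⊗ₜ[ℂ] q j) := by
    intro m n x y p q f g hx hy
    simp only [map_sum, LinearMap.sum_apply, form_tmul, hx, hy, hS, star_sum,
      TensorProduct.star_tmul, Finset.sum_mul_sum, Algebra.TensorProduct.tmul_mul_tmul,
      TensorProduct.sum_tmul]
    rw [Finset.sum_comm]
    conv_lhs => enter [2, i]; rw [Finset.sum_comm]
    conv_rhs => rw [Finset.sum_comm]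
  exact ⟨_, inferInstance, fun r => ∑ i, S r (Sum.inl i) ⊗ₜ[ℂ] b i,
    fun r => ∑ i, S r (Sum.inr i) ⊗ₜ[ℂ] c i,
    key _ _ _ _ _ _ _ _ (fun _ => rfl) (fun _ => rfl),
    key _ _ _ _ _ _ _ _ (fun _ => rfl) (fun _ => rfl),
    key _ _ _ _ _ _ _ _ (fun _ => rfl) (fun _ => rfl)⟩

/-- The norm of `E ⊗ B` on the algebraic tensor product: `‖v‖ = ‖⟨v, v⟩‖ ^ (1 / 2)`. -/
def extNorm (v : E ⊗[ℂ] B) : ℝ := √(minNorm (form A E B v v))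

theorem minNorm_form_le (v w : E ⊗[ℂ] B) :
    minNorm (form A E B v w) ≤ extNorm (A := A) v * extNorm (A := A) w := by
  obtain ⟨I, _, s, t, h1, h2, h3⟩ := exists_form_factor (A := A) v w
  have h := norm_sum_star_mul_le (fun i => MinTensor.ι A B (s i)) (fun i => MinTensor.ι A B (t i))
  simp only [MinTensor.star_ι, ← map_mul, ← map_sum, MinTensor.norm_ι, ← h1, ← h2, ← h3] at h
  exact h

theorem extNorm_sq (v : E ⊗[ℂ] B) : extNorm (A := A) v ^ 2 = minNorm (form A E B v v) :=
  Real.sq_sqrt (minNorm_nonneg _)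

theorem extNorm_nonneg (v : E ⊗[ℂ] B) : 0 ≤ extNorm (A := A) v := Real.sqrt_nonneg _

theorem extNorm_add_le (v w : E ⊗[ℂ] B) :
    extNorm (A := A) (v + w) ≤ extNorm (A := A) v + extNorm (A := A) w := by
  refine Real.sqrt_le_iff.2 ⟨add_nonneg (extNorm_nonneg v) (extNorm_nonneg w), ?_⟩
  have e : form A E B (v + w) (v + w) =
      (form A E B v v + form A E B v w) + (form A E B w v + form A E B w w) := by
    simp only [map_add, LinearMap.add_apply]
    abel
  rw [e]
  have h1 := minNorm_add_le (form A E B v v + form A E B v w) (form A E B w v + form A E B w w)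
  have h2 := minNorm_add_le (form A E B v v) (form A E B v w)
  have h3 := minNorm_add_le (form A E B w v) (form A E B w w)
  nlinarith [minNorm_form_le (A := A) v v, minNorm_form_le (A := A) v w,
    minNorm_form_le (A := A) w v, minNorm_form_le (A := A) w w]

theorem extNorm_smul (c : ℂ) (v : E ⊗[ℂ] B) :
    extNorm (A := A) (c • v) ≤ ‖c‖ * extNorm (A := A) v := by
  refine Real.sqrt_le_iff.2 ⟨mul_nonneg (norm_nonneg _) (extNorm_nonneg v), ?_⟩
  rw [mul_pow, extNorm_sq, map_smul, map_smulₛₗ, LinearMap.smul_apply]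
  refine (minNorm_smul_le _ _).trans ?_
  rw [sq, mul_assoc]
  gcongr
  refine (minNorm_smul_le _ _).trans_eq ?_
  simp

theorem extNorm_ract_le (v : E ⊗[ℂ] B) (x : A ⊗[ℂ] B) :
    extNorm (A := A) (ract A E B v x) ≤ extNorm (A := A) v * minNorm x := by
  refine Real.sqrt_le_iff.2 ⟨mul_nonneg (extNorm_nonneg v) (minNorm_nonneg x), ?_⟩
  have h1 : form A E B (ract A E B v x) (ract A E B v x) = star x * form A E B v v * x := by
    rw [form_ract, ← star_form, form_ract, star_mul, star_form]
  rw [h1, mul_pow, extNorm_sq]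
  have h2 := minNorm_mul_le (star x * form A E B v v) x
  have h3 := minNorm_mul_le (star x) (form A E B v v)
  rw [minNorm_star] at h3
  have h4 := mul_le_mul_of_nonneg_right h3 (minNorm_nonneg x)
  nlinarith

/-- The algebraic tensor product `E ⊙ B`, as a type carrying the norm `‖⟨v, v⟩‖ ^ (1 / 2)`. -/
@[nolint unusedArguments]
def PreExtTensor (A E B : Type u) [CStarAlgebra A] [CStarAlgebra B] [NormedAddCommGroup E]
    [NormedSpace ℂ E] [CompleteSpace E] [Module Aᵐᵒᵖ E] [HilbertModule A E] : Type u :=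
  E ⊗[ℂ] B

namespace PreExtTensor

instance : AddCommGroup (PreExtTensor A E B) := inferInstanceAs (AddCommGroup (E ⊗[ℂ] B))
instance : Module ℂ (PreExtTensor A E B) := inferInstanceAs (Module ℂ (E ⊗[ℂ] B))

variable (A E B) in
def seminorm : AddGroupSeminorm (PreExtTensor A E B) where
  toFun v := extNorm (A := A) (E := E) (B := B) v
  map_zero' := le_antisymm ((congrArg _ (zero_smul ℂ _).symm).trans_le
    ((extNorm_smul (A := A) (E := E) (B := B) 0 0).trans_eq (by simp))) (extNorm_nonneg _)
  add_le' := extNorm_add_le (A := A) (E := E) (B := B)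
  neg' v := by
    have h : ∀ w : E ⊗[ℂ] B, extNorm (A := A) (-w) ≤ extNorm (A := A) w := fun w => by
      have := extNorm_smul (A := A) (-1) w
      simpa using this
    exact le_antisymm (h v) ((congrArg _ (neg_neg v).symm).trans_le (h (-v)))

instance : SeminormedAddCommGroup (PreExtTensor A E B) where
  toAddCommGroup := inferInstance
  __ := (seminorm A E B).toSeminormedAddCommGroup

instance : NormedSpace ℂ (PreExtTensor A E B) where
  norm_smul_le c v := extNorm_smul (A := A) (E := E) (B := B) c v

end PreExtTensor

/-- The exterior tensor product `E ⊗ B` of a Hilbert `A`-module `E` and a C⋆-algebra `B`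
(viewed as a Hilbert module over itself); it is a Hilbert `A ⊗ B`-module. -/
def ExtTensor (A E B : Type u) [CStarAlgebra A] [CStarAlgebra B] [NormedAddCommGroup E]
    [NormedSpace ℂ E] [CompleteSpace E] [Module Aᵐᵒᵖ E] [HilbertModule A E] : Type u :=
  Completion (PreExtTensor A E B)

namespace ExtTensor

instance : NormedAddCommGroup (ExtTensor A E B) :=
  inferInstanceAs (NormedAddCommGroup (Completion (PreExtTensor A E B)))
instance : NormedSpace ℂ (ExtTensor A E B) :=
  inferInstanceAs (NormedSpace ℂ (Completion (PreExtTensor A E B)))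
instance : CompleteSpace (ExtTensor A E B) :=
  inferInstanceAs (CompleteSpace (Completion (PreExtTensor A E B)))

variable (A E B) in
/-- The canonical map from the algebraic tensor product to the exterior tensor product. -/
def ι : E ⊗[ℂ] B →ₗ[ℂ] ExtTensor A E B where
  toFun x := ((show PreExtTensor A E B from x) : Completion (PreExtTensor A E B))
  map_add' x y := Completion.coe_add (α := PreExtTensor A E B) x y
  map_smul' c x := Completion.coe_smul (X := PreExtTensor A E B) c x

theorem norm_ι (v : E ⊗[ℂ] B) : ‖ι A E B v‖ = extNorm (A := A) v :=
  Completion.norm_coe (E := PreExtTensor A E B) v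

theorem denseRange_ι : DenseRange (ι A E B) :=
  Completion.denseRange_coe (α := PreExtTensor A E B)

theorem induction {p : ExtTensor A E B → Prop} (hc : IsClosed {x | p x})
    (h : ∀ x, p (ι A E B x)) (x : ExtTensor A E B) : p x :=
  denseRange_ι.induction_on x hc h

variable (A E B) in
/-- The inner product on `E ⊗ B` with `⟨ξ ⊗ b, η ⊗ c⟩ = ⟨ξ, η⟩ ⊗ b⋆ c`. -/
def ipL : ExtTensor A E B →L⋆[ℂ] ExtTensor A E B →L[ℂ] MinTensor A B :=
  ext₂ (ι A E B) (ι A E B) denseRange_ι ((form A E B).compr₂ₛₗ (MinTensor.ι A B).toLinearMap)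
    fun v w => by
      rw [norm_ι, norm_ι]
      exact (MinTensor.norm_ι _).trans_le (minNorm_form_le v w)

theorem ipL_ι (v w : E ⊗[ℂ] B) :
    ipL A E B (ι A E B v) (ι A E B w) = MinTensor.ι A B (form A E B v w) :=
  ext₂_eq _ _ denseRange_ι denseRange_ι _ _ v w

variable (A E B) in
/-- The right action of `A ⊗ B` on `E ⊗ B` with `(ξ ⊗ b) (a ⊗ c) = ξ a ⊗ b c`. -/
def ractL : ExtTensor A E B →L[ℂ] MinTensor A B →L[ℂ] ExtTensor A E B :=
  ext₂ (ι A E B) (MinTensor.ι A B).toLinearMap MinTensor.denseRange_ι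
    ((ract A E B).compr₂ (ι A E B))
    fun v x => by
      refine (norm_ι _).trans_le ((extNorm_ract_le v x).trans_eq ?_)
      rw [norm_ι]
      exact congrArg _ (MinTensor.norm_ι x).symm

theorem ractL_ι (v : E ⊗[ℂ] B) (x : A ⊗[ℂ] B) :
    ractL A E B (ι A E B v) (MinTensor.ι A B x) = ι A E B (ract A E B v x) :=
  ext₂_eq _ (MinTensor.ι A B).toLinearMap denseRange_ι MinTensor.denseRange_ι _ _ v x

theorem ractL_mul (v : ExtTensor A E B) (x y : MinTensor A B) :
    ractL A E B v (x * y) = ractL A E B (ractL A E B v x) y := by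
  revert x y
  refine MinTensor.induction₂ (isClosed_eq (by fun_prop) (by fun_prop)) fun x y => ?_
  revert v
  refine induction (isClosed_eq (by fun_prop) (by fun_prop)) fun v => ?_
  rw [← map_mul, ractL_ι, ractL_ι, ractL_ι]
  congr 1
  induction v with
  | zero => simp
  | add y z hy hz => simp only [map_add, LinearMap.add_apply, hy, hz]
  | tmul ξ b =>
    induction x with
    | zero => simp
    | add y z hy hz => simp only [map_add, add_mul, LinearMap.add_apply, hy, hz]
    | tmul a c =>
      induction y with
      | zero => simp
      | add y z hy hz => simp only [map_add, mul_add, hy, hz]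
      | tmul a d => simp [mul_smul, mul_assoc]

theorem ractL_one (v : ExtTensor A E B) : ractL A E B v 1 = v := by
  revert v
  refine induction (isClosed_eq (by fun_prop) (by fun_prop)) fun v => ?_
  rw [← map_one (MinTensor.ι A B), ractL_ι]
  congr 1
  induction v with
  | zero => simp
  | add y z hy hz => simp only [map_add, LinearMap.add_apply, hy, hz]
  | tmul ξ b => simp [Algebra.TensorProduct.one_def]

instance : Module (MinTensor A B)ᵐᵒᵖ (ExtTensor A E B) where
  smul x v := ractL A E B v x.unop
  one_smul v := ractL_one v
  mul_smul x y v := ractL_mul v y.unop x.unop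
  smul_zero x := by
    change ractL A E B 0 x.unop = 0
    simp
  smul_add x v w := by
    change ractL A E B (v + w) x.unop = ractL A E B v x.unop + ractL A E B w x.unop
    simp
  add_smul x y v := map_add (ractL A E B v) x.unop y.unop
  zero_smul v := map_zero (ractL A E B v)

instance : HilbertModule (MinTensor A B) (ExtTensor A E B) where
  ip v w := ipL A E B v w
  ip_add_right v := map_add (ipL A E B v)
  ip_smul_right c v := map_smul (ipL A E B v) c
  ip_op_smul_right x v w := by
    change ipL A E B v (ractL A E B w x) = _
    revert x
    refine MinTensor.induction (isClosed_eq (by fun_prop) (by fun_prop)) fun x => ?_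
    revert v
    refine induction (isClosed_eq (by fun_prop) (by fun_prop)) fun v => ?_
    revert w
    refine induction (isClosed_eq (by fun_prop) (by fun_prop)) fun w => ?_
    rw [ractL_ι, ipL_ι, ipL_ι, form_ract, map_mul]
  star_ip v w := by
    revert v
    refine induction (isClosed_eq (by fun_prop) (by fun_prop)) fun v => ?_
    revert w
    refine induction (isClosed_eq (by fun_prop) (by fun_prop)) fun w => ?_
    rw [ipL_ι, ipL_ι, MinTensor.star_ι, star_form]
  ip_self_nonneg v := by
    let _ := CStarAlgebra.spectralOrder (MinTensor A B)
    have _ := CStarAlgebra.spectralOrderedRing (MinTensor A B)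
    refine CStarAlgebra.nonneg_iff_eq_star_mul_self.1 ?_
    revert v
    refine induction (isClosed_le (by fun_prop) (by fun_prop)) fun v => ?_
    obtain ⟨I, _, s, t, h1, -, -⟩ := exists_form_factor (A := A) v v
    rw [ipL_ι, h1, map_sum]
    refine Finset.sum_nonneg fun i _ => ?_
    rw [map_mul, ← MinTensor.star_ι]
    exact star_mul_self_nonneg _
  norm_sq v := by
    revert v
    refine induction (isClosed_eq (by fun_prop) (by fun_prop)) fun v => ?_
    rw [norm_ι, ipL_ι, MinTensor.norm_ι, extNorm_sq]

/-- The elementary tensor `ξ ⊗ b`. -/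
def tmul (ξ : E) (b : B) : ExtTensor A E B := ι A E B (ξ ⊗ₜ b)

end ExtTensor

end Ext

section Induced

variable {A E A' : Type u} [CStarAlgebra A] [CStarAlgebra A'] [NormedAddCommGroup E]
    [NormedSpace ℂ E] [CompleteSpace E] [Module Aᵐᵒᵖ E] [HilbertModule A E]

namespace HilbertRep

variable (E) in
/-- The form on `E ⊙ H` with `⟨ξ ⊗ h, η ⊗ k⟩ = ⟨h, π(⟨ξ, η⟩) k⟩`. -/
def gform (R : HilbertRep A) : E ⊗[ℂ] R.H →ₗ⋆[ℂ] E ⊗[ℂ] R.H →ₗ[ℂ] ℂ :=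
  TensorProduct.lift (LinearMap.mk₂'ₛₗ (starRingEnd ℂ) (starRingEnd ℂ)
    (fun (ξ : E) (h : R.H) => TensorProduct.lift (LinearMap.mk₂ ℂ
      (fun (η : E) (k : R.H) => ⟪h, R.π (hip A ξ η) k⟫_ℂ)
      (fun x y k => by simp [hip_add_right])
      (fun c x k => by simp [hip_smul_right])
      (fun x k l => by simp)
      (fun c x k => by simp)))
    (fun x y h => by
      ext η k
      simp [hip_add_left])
    (fun c x h => by
      ext η k
      simp [hip_smul_left])
    (fun x h k => by
      ext η l
      simp)
    (fun c x h => by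
      ext η k
      simp [mul_comm]))

@[simp] theorem gform_tmul (R : HilbertRep A) (ξ η : E) (h k : R.H) :
    R.gform E (ξ ⊗ₜ h) (η ⊗ₜ k) = ⟪h, R.π (hip A ξ η) k⟫_ℂ := rfl

theorem conj_gform (R : HilbertRep A) (v w : E ⊗[ℂ] R.H) :
    (starRingEnd ℂ) (R.gform E w v) = R.gform E v w := by
  induction v with
  | zero => simp
  | add x y hx hy => simp [hx, hy]
  | tmul ξ h =>
    induction w with
    | zero => simp
    | add x y hx hy => simp only [map_add, hx, hy, LinearMap.add_apply]
    | tmul η k => rw [gform_tmul, gform_tmul, inner_conj_symm, inner_π, star_hip]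

theorem gform_self (R : HilbertRep A) (v : E ⊗[ℂ] R.H) :
    ∃ r : ℝ, 0 ≤ r ∧ R.gform E v v = r := by
  obtain ⟨k, ξ, h, rfl⟩ := TensorProduct.exists_sum_tmul_eq v
  obtain ⟨S, hS⟩ := exists_gram_factor (A := A) ξ
  refine ⟨∑ r, ‖∑ i, R.π (S r i) (h i)‖ ^ 2, Finset.sum_nonneg fun r _ => by positivity, ?_⟩
  simp only [map_sum, LinearMap.sum_apply, gform_tmul, hS, sum_apply, inner_sum,
    Complex.ofReal_sum, Complex.ofReal_pow]
  have : ∀ x : R.H, (‖x‖ : ℂ) ^ 2 = ⟪x, x⟫_ℂ := fun x => (inner_self_eq_norm_sq_to_K x).symm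
  simp only [this, sum_inner, inner_sum, inner_π, map_mul, mul_apply_eq_comp]
  conv_lhs => enter [2, i]; rw [Finset.sum_comm]
  rw [Finset.sum_comm]

/-- The semi-inner product space `E ⊙ H`. -/
@[nolint unusedArguments]
def PreInd (R : HilbertRep A) (E : Type u) [NormedAddCommGroup E] [NormedSpace ℂ E]
    [CompleteSpace E] [Module Aᵐᵒᵖ E] [HilbertModule A E] : Type u := E ⊗[ℂ] R.H

instance (R : HilbertRep A) : AddCommGroup (R.PreInd E) :=
  inferInstanceAs (AddCommGroup (E ⊗[ℂ] R.H))
instance (R : HilbertRep A) : Module ℂ (R.PreInd E) := inferInstanceAs (Module ℂ (E ⊗[ℂ] R.H))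

variable (E) in
abbrev preIndCore (R : HilbertRep A) : PreInnerProductSpace.Core ℂ (R.PreInd E) where
  inner v w := R.gform E v w
  conj_inner_symm v w := R.conj_gform v w
  re_inner_nonneg v := by
    obtain ⟨r, hr, h⟩ := R.gform_self v
    rw [h]
    simpa using hr
  add_left u v w := by
    exact LinearMap.congr_fun ((R.gform E).map_add u v) w
  smul_left v w c := by
    exact LinearMap.congr_fun ((R.gform E).map_smulₛₗ c v) w

instance (R : HilbertRep A) : SeminormedAddCommGroup (R.PreInd E) :=
  InnerProductSpace.Core.toSeminormedAddCommGroup (c := R.preIndCore E)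
instance (R : HilbertRep A) : InnerProductSpace ℂ (R.PreInd E) :=
  InnerProductSpace.ofCore (R.preIndCore E)

theorem preInd_inner (R : HilbertRep A) (v w : R.PreInd E) : ⟪v, w⟫_ℂ = R.gform E v w := rfl

theorem preInd_norm_sq (R : HilbertRep A) (v : R.PreInd E) :
    ((‖v‖ ^ 2 : ℝ) : ℂ) = R.gform E v v := by
  rw [← R.preInd_inner, inner_self_eq_norm_sq_to_K]
  simp

theorem exists_norm_sq_sub (a : A) :
    ∃ b : A, star a * a = ((‖a‖ ^ 2 : ℝ) : ℂ) • 1 - star b * b := by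
  let _ := CStarAlgebra.spectralOrder A
  have _ := CStarAlgebra.spectralOrderedRing A
  have h := CStarAlgebra.star_mul_le_algebraMap_norm_sq (a := a)
  obtain ⟨b, hb⟩ := CStarAlgebra.nonneg_iff_eq_star_mul_self.1 (sub_nonneg.2 h)
  refine ⟨b, ?_⟩
  rw [← hb, Complex.coe_smul, ← Algebra.algebraMap_eq_smul_one, sub_sub_cancel]

/-- `φ(a) ⊗ 1` on `E ⊙ H`. -/
def act (φ : A' →⋆ₐ[ℂ] Adjointable A E) (R : HilbertRep A) : A' →ₗ[ℂ] E ⊗[ℂ] R.H →ₗ[ℂ] E ⊗[ℂ] R.H where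
  toFun a := LinearMap.rTensor R.H (φ a).lin
  map_add' a b := by
    ext ξ h
    simp [Adjointable.lin, Adjointable.add_apply, TensorProduct.add_tmul]
  map_smul' c a := by
    ext ξ h
    simp [Adjointable.lin, Adjointable.smul_apply, TensorProduct.smul_tmul']

@[simp] theorem act_tmul (φ : A' →⋆ₐ[ℂ] Adjointable A E) (R : HilbertRep A) (a : A') (ξ : E)
    (h : R.H) : R.act φ a (ξ ⊗ₜ h) = φ a ξ ⊗ₜ h := rfl

theorem act_mul (φ : A' →⋆ₐ[ℂ] Adjointable A E) (R : HilbertRep A) (a b : A') (v : E ⊗[ℂ] R.H) :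
    R.act φ (a * b) v = R.act φ a (R.act φ b v) := by
  induction v with
  | zero => simp
  | add x y hx hy => simp only [map_add, hx, hy]
  | tmul ξ h => simp [Adjointable.mul_apply]

theorem act_one (φ : A' →⋆ₐ[ℂ] Adjointable A E) (R : HilbertRep A) (v : E ⊗[ℂ] R.H) :
    R.act φ 1 v = v := by
  induction v with
  | zero => simp
  | add x y hx hy => simp only [map_add, hx, hy]
  | tmul ξ h => simp [Adjointable.one_apply]

theorem gform_act (φ : A' →⋆ₐ[ℂ] Adjointable A E) (R : HilbertRep A) (a : A')
    (v w : E ⊗[ℂ] R.H) : R.gform E (R.act φ a v) w = R.gform E v (R.act φ (star a) w) := by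
  induction v with
  | zero => simp
  | add x y hx hy => simp [hx, hy]
  | tmul ξ h =>
    induction w with
    | zero => simp
    | add x y hx hy => simp only [map_add, hx, hy]
    | tmul η k =>
      rw [act_tmul, act_tmul, gform_tmul, gform_tmul, (φ a).hip_adj, map_star]
      rfl

theorem gform_act_self (φ : A' →⋆ₐ[ℂ] Adjointable A E) (R : HilbertRep A) (a b : A')
    (hb : star a * a = ((‖a‖ ^ 2 : ℝ) : ℂ) • 1 - star b * b) (v : E ⊗[ℂ] R.H) :
    R.gform E (R.act φ a v) (R.act φ a v) =
      ((‖a‖ ^ 2 : ℝ) : ℂ) * R.gform E v v - R.gform E (R.act φ b v) (R.act φ b v) := by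
  rw [gform_act, gform_act, ← act_mul, ← act_mul, hb, map_sub, map_smul, LinearMap.sub_apply,
    LinearMap.smul_apply, act_one, map_sub, map_smul, smul_eq_mul]

theorem norm_act_le (φ : A' →⋆ₐ[ℂ] Adjointable A E) (R : HilbertRep A) (a : A')
    (v : R.PreInd E) : ‖(show R.PreInd E from R.act φ a v)‖ ≤ ‖a‖ * ‖v‖ := by
  obtain ⟨b, hb⟩ := exists_norm_sq_sub a
  obtain ⟨r, hr, h⟩ := R.gform_self (R.act φ b v)
  refine le_of_sq_le_sq ?_ (by positivity)
  have h1 := R.gform_act_self φ a b hb v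
  rw [h] at h1
  have h2 := (R.preInd_norm_sq (E := E) (R.act φ a v)).trans h1
  rw [← R.preInd_norm_sq (E := E) v] at h2
  have h3 : ‖(show R.PreInd E from R.act φ a v)‖ ^ 2 = ‖a‖ ^ 2 * ‖v‖ ^ 2 - r := by
    exact_mod_cast h2
  rw [h3, mul_pow]
  linarith

variable (E) in
/-- The canonical map of `E ⊙ H` to its completion. -/
def indι (R : HilbertRep A) : E ⊗[ℂ] R.H →ₗ[ℂ] Completion (R.PreInd E) where
  toFun x := ((show R.PreInd E from x) : Completion (R.PreInd E))
  map_add' x y := Completion.coe_add (α := R.PreInd E) x y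
  map_smul' c x := Completion.coe_smul (X := R.PreInd E) c x

theorem norm_indι (R : HilbertRep A) (v : E ⊗[ℂ] R.H) :
    ‖R.indι E v‖ = ‖(show R.PreInd E from v)‖ := Completion.norm_coe (E := R.PreInd E) v

theorem inner_indι (R : HilbertRep A) (v w : E ⊗[ℂ] R.H) :
    ⟪R.indι E v, R.indι E w⟫_ℂ = R.gform E v w :=
  Completion.inner_coe (𝕜 := ℂ) (E := R.PreInd E) v w

theorem denseRange_indι (R : HilbertRep A) : DenseRange (R.indι E) :=
  Completion.denseRange_coe (α := R.PreInd E)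

/-- `φ(a) ⊗ 1` on the completion of `E ⊙ H`. -/
def indL (φ : A' →⋆ₐ[ℂ] Adjointable A E) (R : HilbertRep A) (a : A') :
    Completion (R.PreInd E) →L[ℂ] Completion (R.PreInd E) :=
  ((R.indι E).comp (R.act φ a)).extendOfNorm (R.indι E)

theorem indL_ι (φ : A' →⋆ₐ[ℂ] Adjointable A E) (R : HilbertRep A) (a : A') (v : E ⊗[ℂ] R.H) :
    R.indL φ a (R.indι E v) = R.indι E (R.act φ a v) :=
  LinearMap.extendOfNorm_eq (R.denseRange_indι (E := E)) ⟨‖a‖, fun v => by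
    rw [norm_indι, LinearMap.comp_apply, norm_indι]
    exact R.norm_act_le φ a v⟩ v

theorem indL_ext {R : HilbertRep A} {S T : Completion (R.PreInd E) →L[ℂ] Completion (R.PreInd E)}
    (h : ∀ v, S (R.indι E v) = T (R.indι E v)) : S = T :=
  DFunLike.coe_injective ((R.denseRange_indι (E := E)).equalizer S.continuous T.continuous
    (funext h))

/-- The representation of `A'` on the completion of `E ⊙ H` induced by `φ : A' → 𝓛(E)`. -/
def ind (φ : A' →⋆ₐ[ℂ] Adjointable A E) (R : HilbertRep A) : HilbertRep A' where
  H := Completion (R.PreInd E)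
  π :=
    { toFun := R.indL φ
      map_one' := indL_ext fun v => by rw [indL_ι, act_one]; rfl
      map_mul' := fun a b => indL_ext fun v => by
        rw [mul_apply_eq_comp, indL_ι, indL_ι, indL_ι, act_mul]
      map_zero' := indL_ext fun v => by
        rw [indL_ι, map_zero, LinearMap.zero_apply, map_zero]; rfl
      map_add' := fun a b => indL_ext fun v => by
        rw [indL_ι, map_add, LinearMap.add_apply, map_add, ← indL_ι, ← indL_ι]; rfl
      commutes' := fun c => indL_ext fun v => by
        rw [indL_ι, Algebra.algebraMap_eq_smul_one, map_smul, LinearMap.smul_apply, act_one,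
          map_smul, Algebra.algebraMap_eq_smul_one]
        rfl
      map_star' := fun a => by
        rw [ContinuousLinearMap.star_eq_adjoint, ContinuousLinearMap.eq_adjoint_iff]
        intro x y
        refine (R.denseRange_indι (E := E)).induction_on₂
          (p := fun x y => ⟪R.indL φ (star a) x, y⟫_ℂ = ⟪x, R.indL φ a y⟫_ℂ)
          (isClosed_eq (by fun_prop) (by fun_prop)) (fun v w => ?_) x y
        rw [indL_ι, indL_ι, inner_indι, inner_indι, gform_act, star_star] }

end HilbertRep
end Induced

section LeftAction

variable {A E B A' : Type u} [CStarAlgebra A] [CStarAlgebra B] [CStarAlgebra A']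
    [NormedAddCommGroup E] [NormedSpace ℂ E] [CompleteSpace E] [Module Aᵐᵒᵖ E] [HilbertModule A E]

namespace HilbertRep

/-- For `v = ξ ⊗ b`, the map `h ⊗ k ↦ (ξ ⊗ h) ⊗ ρ(b) k`. -/
def creation (R : HilbertRep A) (S : HilbertRep B) :
    E ⊗[ℂ] B →ₗ[ℂ] R.H ⊗[ℂ] S.H →ₗ[ℂ] Completion (R.PreInd E) ⊗[ℂ] S.H :=
  (TensorProduct.homTensorHomMap (RingHom.id ℂ) R.H S.H (Completion (R.PreInd E)) S.H).comp
    (TensorProduct.map ((TensorProduct.mk ℂ E R.H).compr₂ (R.indι E))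
      { toFun := fun b => (S.π b).toLinearMap
        map_add' := fun b c => by rw [map_add]; rfl
        map_smul' := fun c b => by rw [map_smul]; rfl })

theorem creation_tmul (R : HilbertRep A) (S : HilbertRep B) (ξ : E) (b : B) (h : R.H) (k : S.H) :
    R.creation S (ξ ⊗ₜ b) (h ⊗ₜ k) = R.indι E (ξ ⊗ₜ h) ⊗ₜ S.π b k := rfl

theorem inner_creation (R : HilbertRep A) (S : HilbertRep B) (v w : E ⊗[ℂ] B)
    (z y : R.H ⊗[ℂ] S.H) :
    ⟪R.creation S v z, R.creation S w y⟫_ℂ = ⟪z, R.tensor S (form A E B v w) y⟫_ℂ := by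
  induction v with
  | zero => simp
  | add x y hx hy => simp [inner_add_left, inner_add_right, hx, hy]
  | tmul ξ b =>
    induction w with
    | zero => simp
    | add x y hx hy => simp only [map_add, LinearMap.add_apply, inner_add_right, hx, hy,
        add_apply]
    | tmul η c =>
      induction z with
      | zero => simp
      | add x y hx hy => simp only [map_add, inner_add_left, hx, hy]
      | tmul h k =>
        induction y with
        | zero => simp
        | add x y hx hy => simp only [map_add, inner_add_right, hx, hy]
        | tmul h' k' =>
          rw [creation_tmul, creation_tmul, TensorProduct.inner_tmul, inner_indι, gform_tmul,
            form_tmul, tensor_tmul, inner_π]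
          simp

end HilbertRep

variable (B) in
/-- The left action of `A' ⊙ B` on `E ⊙ B` with `(a ⊗ b) (ξ ⊗ c) = φ(a) ξ ⊗ b c`. -/
def lalg (φ : A' →⋆ₐ[ℂ] Adjointable A E) : A' ⊗[ℂ] B →ₗ[ℂ] E ⊗[ℂ] B →ₗ[ℂ] E ⊗[ℂ] B :=
  (TensorProduct.homTensorHomMap (RingHom.id ℂ) E B E B).comp
    (TensorProduct.map
      { toFun := fun a => (φ a).lin
        map_add' := fun a b => by rw [map_add]; rfl
        map_smul' := fun c a => by rw [map_smul]; rfl }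
      (LinearMap.mul ℂ B))

@[simp] theorem lalg_tmul (φ : A' →⋆ₐ[ℂ] Adjointable A E) (a : A') (b c : B) (ξ : E) :
    lalg B φ (a ⊗ₜ b) (ξ ⊗ₜ c) = φ a ξ ⊗ₜ (b * c) := rfl

theorem creation_lalg (φ : A' →⋆ₐ[ℂ] Adjointable A E) (R : HilbertRep A) (S : HilbertRep B)
    (x : A' ⊗[ℂ] B) (v : E ⊗[ℂ] B) (z : R.H ⊗[ℂ] S.H) :
    R.creation S (lalg B φ x v) z = (R.ind φ).tensor S x (R.creation S v z) := by
  induction x with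
  | zero => simp only [map_zero, LinearMap.zero_apply]; rfl
  | add x y hx hy =>
    rw [map_add, LinearMap.add_apply, map_add, LinearMap.add_apply, hx, hy, map_add]; rfl
  | tmul a b =>
    induction v with
    | zero =>
      simp only [map_zero, LinearMap.zero_apply]
      exact (((R.ind φ).tensor S (a ⊗ₜ b)).map_zero).symm
    | add x y hx hy =>
      simp only [map_add, LinearMap.add_apply, hx, hy]
      exact (((R.ind φ).tensor S (a ⊗ₜ b)).map_add _ _).symm
    | tmul ξ c =>
      induction z with
      | zero =>
        simp only [map_zero]
        exact (((R.ind φ).tensor S (a ⊗ₜ b)).map_zero).symm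
      | add x y hx hy =>
        simp only [map_add, hx, hy]
        exact (((R.ind φ).tensor S (a ⊗ₜ b)).map_add _ _).symm
      | tmul h k =>
        rw [lalg_tmul, HilbertRep.creation_tmul, HilbertRep.creation_tmul, map_mul]
        change _ = R.indL φ a (R.indι E (ξ ⊗ₜ h)) ⊗ₜ S.π b (S.π c k)
        rw [HilbertRep.indL_ι]
        rfl

theorem norm_creation_le (R : HilbertRep A) (S : HilbertRep B) (v : E ⊗[ℂ] B)
    (z : R.H ⊗[ℂ] S.H) : ‖R.creation S v z‖ ≤ extNorm (A := A) v * ‖z‖ := by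
  refine le_of_sq_le_sq ?_ (mul_nonneg (extNorm_nonneg v) (norm_nonneg z))
  rw [mul_pow, extNorm_sq, ← inner_self_eq_norm_sq (𝕜 := ℂ), R.inner_creation S]
  refine (RCLike.re_le_norm _).trans ((norm_inner_le_norm z _).trans ?_)
  have h1 := (R.tensor S (form A E B v v)).le_opNorm z
  have h2 := norm_tensor_le R S (form A E B v v)
  nlinarith [norm_nonneg z, mul_le_mul_of_nonneg_right h2 (norm_nonneg z)]

theorem extNorm_lalg_le (φ : A' →⋆ₐ[ℂ] Adjointable A E) (x : A' ⊗[ℂ] B) (v : E ⊗[ℂ] B) :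
    extNorm (A := A) (lalg B φ x v) ≤ minNorm x * extNorm (A := A) v := by
  have h0 := mul_nonneg (minNorm_nonneg x) (extNorm_nonneg (A := A) v)
  refine Real.sqrt_le_iff.2 ⟨h0, minNorm_le fun R S => ?_⟩
  have key : ∀ z, ‖R.creation S (lalg B φ x v) z‖ ≤ minNorm x * extNorm (A := A) v * ‖z‖ :=
    fun z => by
      rw [creation_lalg]
      refine (ContinuousLinearMap.le_opNorm _ _).trans ?_
      rw [mul_assoc]
      exact mul_le_mul (norm_tensor_le _ _ x) (norm_creation_le R S v z) (norm_nonneg _)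
        (minNorm_nonneg x)
  refine ContinuousLinearMap.opNorm_le_bound _ (sq_nonneg _) fun z => ?_
  set y := R.tensor S (form A E B (lalg B φ x v) (lalg B φ x v)) z with hy
  rcases (norm_nonneg y).eq_or_lt with h | h
  · rw [← h]; positivity
  refine le_of_mul_le_mul_right ?_ h
  have e : ‖y‖ * ‖y‖ = ‖⟪y, y⟫_ℂ‖ := by
    have := inner_self_eq_norm_mul_norm (𝕜 := ℂ) y
    rw [← this, inner_self_re_eq_norm]
  rw [e]
  nth_rw 2 [hy]
  rw [← R.inner_creation S]
  refine (norm_inner_le_norm _ _).trans ((mul_le_mul (key y) (key z) (norm_nonneg _)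
    (mul_nonneg h0 (norm_nonneg _))).trans_eq ?_)
  ring

namespace ExtTensor

variable (B) in
/-- The left action `φ ⊗ id` of `A' ⊗ B` on `E ⊗ B`, for `φ : A' → 𝓛(E)`; it satisfies
`(a ⊗ b) (ξ ⊗ c) = φ(a) ξ ⊗ b c`. -/
def lact (φ : A' →⋆ₐ[ℂ] Adjointable A E) :
    MinTensor A' B →L[ℂ] ExtTensor A E B →L[ℂ] ExtTensor A E B :=
  ext₂ (MinTensor.ι A' B).toLinearMap (ι A E B) denseRange_ι
    ((lalg B φ).compr₂ (ι A E B))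
    fun x v => by
      refine (norm_ι _).trans_le ((extNorm_lalg_le φ x v).trans_eq ?_)
      rw [norm_ι]
      exact congrArg (· * _) (MinTensor.norm_ι x).symm

theorem lact_ι (φ : A' →⋆ₐ[ℂ] Adjointable A E) (x : A' ⊗[ℂ] B) (v : E ⊗[ℂ] B) :
    lact B φ (MinTensor.ι A' B x) (ι A E B v) = ι A E B (lalg B φ x v) :=
  ext₂_eq (MinTensor.ι A' B).toLinearMap _ MinTensor.denseRange_ι denseRange_ι _ _ x v

end ExtTensor

end LeftAction

section TensorMaps

variable {A B A' B' E F O : Type u} [CStarAlgebra A] [CStarAlgebra B] [CStarAlgebra A']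
    [CStarAlgebra B'] [CStarAlgebra O] [NormedAddCommGroup E] [NormedSpace ℂ E] [CompleteSpace E]
    [Module Aᵐᵒᵖ E] [HilbertModule A E] [NormedAddCommGroup F] [NormedSpace ℂ F] [CompleteSpace F]
    [Module A'ᵐᵒᵖ F] [HilbertModule A' F]

namespace ExtTensor

/-- The continuous linear map `f ⊗ g : E ⊗ B → F ⊗ B'`, for a linear map `f : E → F` that is
compatible with the inner products (see `ExtTensor.map_ι`) and a unital `⋆`-homomorphism `g`. -/
def map (A A' : Type u) [CStarAlgebra A] [CStarAlgebra A'] [Module Aᵐᵒᵖ E] [HilbertModule A E]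
    [Module A'ᵐᵒᵖ F] [HilbertModule A' F] (f : E →ₗ[ℂ] F) (g : B →⋆ₐ[ℂ] B') :
    ExtTensor A E B →L[ℂ] ExtTensor A' F B' :=
  ((ι A' F B').comp (TensorProduct.map f g.toAlgHom.toLinearMap)).extendOfNorm (ι A E B)

theorem map_ι {f : E →ₗ[ℂ] F} (α : A →⋆ₐ[ℂ] A') (g : B →⋆ₐ[ℂ] B')
    (hf : ∀ ξ η, hip A' (f ξ) (f η) = α (hip A ξ η)) (v : E ⊗[ℂ] B) :
    map A A' f g (ι A E B v) = ι A' F B' (TensorProduct.map f g.toAlgHom.toLinearMap v) := by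
  refine LinearMap.extendOfNorm_eq (denseRange_ι (A := A)) ⟨1, fun v => ?_⟩ v
  have key : ∀ v w : E ⊗[ℂ] B, form A' F B' (TensorProduct.map f g.toAlgHom.toLinearMap v)
      (TensorProduct.map f g.toAlgHom.toLinearMap w) =
        Algebra.TensorProduct.map α.toAlgHom g.toAlgHom (form A E B v w) := fun v w => by
    induction v with
    | zero => simp
    | add x y hx hy => simp only [map_add, LinearMap.add_apply, hx, hy]
    | tmul ξ b =>
      induction w with
      | zero => simp
      | add x y hx hy => simp only [map_add, hx, hy]
      | tmul η c => simp [hf, map_star]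
  rw [one_mul, norm_ι, LinearMap.comp_apply, norm_ι]
  refine Real.sqrt_le_sqrt ?_
  rw [key]
  exact MinTensor.minNorm_map_le α g _

/-- The continuous linear map `t ⊗ id : E ⊗ B → O ⊗ B`, for a linear map `t` from `E` to a
C⋆-algebra `O` with `t(ξ)⋆ t(η) = π(⟨ξ, η⟩)` (see `ExtTensor.mapAlg_ι`). -/
def mapAlg (A B : Type u) [CStarAlgebra A] [CStarAlgebra B] [Module Aᵐᵒᵖ E] [HilbertModule A E]
    (t : E →ₗ[ℂ] O) : ExtTensor A E B →L[ℂ] MinTensor O B :=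
  ((MinTensor.ι O B).toLinearMap.comp (LinearMap.rTensor B t)).extendOfNorm (ι A E B)

theorem mapAlg_ι {t : E →ₗ[ℂ] O} {π : A →⋆ₐ[ℂ] O}
    (ht : ∀ ξ η, star (t ξ) * t η = π (hip A ξ η)) (v : E ⊗[ℂ] B) :
    mapAlg A B t (ι A E B v) = MinTensor.ι O B (LinearMap.rTensor B t v) := by
  refine LinearMap.extendOfNorm_eq (denseRange_ι (A := A)) ⟨1, fun v => ?_⟩ v
  have key : ∀ v w : E ⊗[ℂ] B, star (LinearMap.rTensor B t v) * LinearMap.rTensor B t w =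
        Algebra.TensorProduct.map π.toAlgHom (AlgHom.id ℂ B) (form A E B v w) := fun v w => by
    induction v with
    | zero => simp
    | add x y hx hy => simp only [map_add, LinearMap.add_apply, star_add, add_mul, hx, hy]
    | tmul ξ b =>
      induction w with
      | zero => simp
      | add x y hx hy => simp only [map_add, mul_add, hx, hy]
      | tmul η c => simp [ht]
  rw [one_mul, norm_ι]
  refine Real.le_sqrt_of_sq_le ?_
  rw [sq, ← CStarRing.norm_star_mul_self]
  change ‖star (MinTensor.ι O B _) * MinTensor.ι O B _‖ ≤ _
  rw [MinTensor.star_ι, ← map_mul, MinTensor.norm_ι, key]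
  exact MinTensor.minNorm_map_le π (StarAlgHom.id ℂ B) _

end ExtTensor

/-- The canonical identification `(A ⊗ B) ⊗ C = A ⊗ (B ⊗ C)`, as the set of pairs of identified
elements. The identification is the continuous extension of the (isometric) one of the algebraic
tensor products, that is, its graph is the closure of the graph of the latter. -/
def assocGraph (A B C : Type u) [CStarAlgebra A] [CStarAlgebra B] [CStarAlgebra C] :
    Set (MinTensor (MinTensor A B) C × MinTensor A (MinTensor B C)) :=
  closure (Set.range fun x : (A ⊗[ℂ] B) ⊗[ℂ] C =>
    (MinTensor.ι (MinTensor A B) C (LinearMap.rTensor C (MinTensor.ι A B).toLinearMap x),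
      MinTensor.ι A (MinTensor B C) (LinearMap.lTensor A (MinTensor.ι B C).toLinearMap
        (TensorProduct.assoc ℂ A B C x))))

/-- The canonical identification `(E ⊗ B) ⊗ C = E ⊗ (B ⊗ C)` for a Hilbert `A`-module `E`, as the
set of pairs of identified elements. -/
def extAssocGraph (A E B C : Type u) [CStarAlgebra A] [CStarAlgebra B] [CStarAlgebra C]
    [NormedAddCommGroup E] [NormedSpace ℂ E] [CompleteSpace E] [Module Aᵐᵒᵖ E]
    [HilbertModule A E] :
    Set (ExtTensor (MinTensor A B) (ExtTensor A E B) C × ExtTensor A E (MinTensor B C)) :=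
  closure (Set.range fun x : (E ⊗[ℂ] B) ⊗[ℂ] C =>
    (ExtTensor.ι (MinTensor A B) (ExtTensor A E B) C
        (LinearMap.rTensor C (ExtTensor.ι A E B) x),
      ExtTensor.ι A E (MinTensor B C) (LinearMap.lTensor E (MinTensor.ι B C).toLinearMap
        (TensorProduct.assoc ℂ E B C x))))

end TensorMaps

section QuantumGroups

/-- A compact quantum group `G` with `C(G) = C`. -/
structure CompactQuantumGroup (C : Type u) [CStarAlgebra C] where
  Δ : C →⋆ₐ[ℂ] MinTensor C C
  coassoc : ∀ c, (MinTensor.map Δ (StarAlgHom.id ℂ C) (Δ c),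
    MinTensor.map (StarAlgHom.id ℂ C) Δ (Δ c)) ∈ assocGraph C C C
  dense_right : Dense (Submodule.span ℂ
    {x | ∃ c d, x = Δ c * MinTensor.tmul 1 d} : Set (MinTensor C C))
  dense_left : Dense (Submodule.span ℂ
    {x | ∃ c d, x = Δ c * MinTensor.tmul d 1} : Set (MinTensor C C))

/-- An action `α` of a compact quantum group on a unital C⋆-algebra `A`: the pair `(A, α)` is a
`G`-C⋆-algebra. -/
structure QuantumAction {C : Type u} [CStarAlgebra C] (G : CompactQuantumGroup C)
    (A : Type u) [CStarAlgebra A] where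
  α : A →⋆ₐ[ℂ] MinTensor A C
  coassoc : ∀ a, (MinTensor.map α (StarAlgHom.id ℂ C) (α a),
    MinTensor.map (StarAlgHom.id ℂ A) G.Δ (α a)) ∈ assocGraph A C C
  podles : Dense (Submodule.span ℂ
    {x | ∃ a c, x = α a * MinTensor.tmul 1 c} : Set (MinTensor A C))

variable {C A : Type u} [CStarAlgebra C] [CStarAlgebra A]

/-- An action `lam` of a compact quantum group on a Hilbert module `E` over a `G`-C⋆-algebra:
the pair `(E, lam)` is a `G`-equivariant Hilbert module. -/
structure ModuleAction {G : CompactQuantumGroup C} (α : QuantumAction G A) (E : Type u)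
    [NormedAddCommGroup E] [NormedSpace ℂ E] [CompleteSpace E] [Module Aᵐᵒᵖ E]
    [HilbertModule A E] where
  lam : E →ₗ[ℂ] ExtTensor A E C
  lam_smul : ∀ (a : A) (ξ : E),
    lam (MulOpposite.op a • ξ) = MulOpposite.op (α.α a) • lam ξ
  lam_inner : ∀ ξ η, hip (MinTensor A C) (lam ξ) (lam η) = α.α (hip A ξ η)
  coassoc : ∀ ξ, (ExtTensor.map A (MinTensor A C) lam (StarAlgHom.id ℂ C) (lam ξ),
    ExtTensor.map A A LinearMap.id G.Δ (lam ξ)) ∈ extAssocGraph A E C C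
  podles : Dense (Submodule.span ℂ
    {v | ∃ (ξ : E) (c : C), v = MulOpposite.op (MinTensor.tmul (1 : A) c) • lam ξ} : Set (ExtTensor A E C))

variable {E : Type u} [NormedAddCommGroup E] [NormedSpace ℂ E] [CompleteSpace E] [Module Aᵐᵒᵖ E]
  [HilbertModule A E]

/-- Given a C⋆-correspondence `(E, φ)`, the equivariance of `φ` that makes `(E, φ, lam)` a
`G`-equivariant C⋆-correspondence: `λ(φ(a) ξ) = (φ ⊗ id)(α(a)) λ(ξ)`. -/
def IsEquivariant {G : CompactQuantumGroup C} {α : QuantumAction G A} (lam : ModuleAction α E)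
    (φ : A →⋆ₐ[ℂ] Adjointable A E) : Prop :=
  ∀ a ξ, lam.lam (φ a ξ) = ExtTensor.lact C φ (α.α a) (lam.lam ξ)

end QuantumGroups

section Pimsner

variable {A E : Type u} [CStarAlgebra A] [NormedAddCommGroup E] [NormedSpace ℂ E]
  [CompleteSpace E] [Module Aᵐᵒᵖ E] [HilbertModule A E]

/-- A representation `(t, π)` of a C⋆-correspondence `(E, φ)` on a unital C⋆-algebra `B`. -/
structure IsRepresentation (φ : A →⋆ₐ[ℂ] Adjointable A E) {B : Type u} [CStarAlgebra B]
    (t : E →ₗ[ℂ] B) (π : A →⋆ₐ[ℂ] B) : Prop where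
  inner : ∀ ξ η, star (t ξ) * t η = π (hip A ξ η)
  left : ∀ a ξ, t (φ a ξ) = π a * t ξ

/-- A covariant representation: `ψ_t(φ(a)) = π(a)` for all `a ∈ (ker φ)^⊥`, where `ψ_t` is the
`⋆`-homomorphism with `ψ_t(θ_{ξ,η}) = t(ξ) t(η)⋆`. The Hilbert module `E` is finitely generated, so
that `ψ_t` is defined on the whole of `𝓛(E)`, which is the span of the operators `θ_{ξ,η}`. -/
structure IsCovariant (φ : A →⋆ₐ[ℂ] Adjointable A E) {B : Type u} [CStarAlgebra B]
    (t : E →ₗ[ℂ] B) (π : A →⋆ₐ[ℂ] B) : Prop extends IsRepresentation φ t π where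
  covariant : ∃ ψ : Adjointable A E →⋆ₙₐ[ℂ] B,
    (∀ ξ η, ψ (Adjointable.theta ξ η) = t ξ * star (t η)) ∧
      ∀ a, (∀ b, φ b = 0 → a * b = 0) → ψ (φ a) = π a

/-- The structure on a unital C⋆-algebra `O` of being the Pimsner algebra of the
C⋆-correspondence `(E, φ)`: a universal covariant representation `(kE, kA)` on `O`. -/
structure PimsnerAlgebra (φ : A →⋆ₐ[ℂ] Adjointable A E) (O : Type u) [CStarAlgebra O] where
  kE : E →ₗ[ℂ] O
  kA : A →⋆ₐ[ℂ] O
  covariant : IsCovariant φ kE kA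
  universal : ∀ (B : Type u) [CStarAlgebra B] (t : E →ₗ[ℂ] B) (π : A →⋆ₐ[ℂ] B),
    IsCovariant φ t π → ∃! ρ : O →⋆ₐ[ℂ] B, (∀ ξ, ρ (kE ξ) = t ξ) ∧ ∀ a, ρ (kA a) = π a

theorem IsCovariant.circle_smul {φ : A →⋆ₐ[ℂ] Adjointable A E} {B : Type u} [CStarAlgebra B]
    {t : E →ₗ[ℂ] B} {π : A →⋆ₐ[ℂ] B} (h : IsCovariant φ t π) (z : Circle) :
    IsCovariant φ ((z : ℂ) • t) π where
  inner ξ η := by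
    rw [← h.inner, LinearMap.smul_apply, LinearMap.smul_apply, star_smul, smul_mul_smul_comm]
    simp [← Complex.normSq_eq_conj_mul_self]
  left a ξ := by simp [h.left]
  covariant := by
    obtain ⟨ψ, h1, h2⟩ := h.covariant
    refine ⟨ψ, fun ξ η => ?_, h2⟩
    rw [h1, LinearMap.smul_apply, LinearMap.smul_apply, star_smul, smul_mul_smul_comm]
    simp [Complex.mul_conj]

namespace PimsnerAlgebra

variable {φ : A →⋆ₐ[ℂ] Adjointable A E} {O : Type u} [CStarAlgebra O]

/-- The integrated form `t × π` of a covariant representation. -/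
def integrated (P : PimsnerAlgebra φ O) {B : Type u} [CStarAlgebra B] {t : E →ₗ[ℂ] B}
    {π : A →⋆ₐ[ℂ] B} (h : IsCovariant φ t π) : O →⋆ₐ[ℂ] B :=
  (P.universal B t π h).choose

/-- The gauge action: `γ_z` is the unital `⋆`-homomorphism with `γ_z(k_E(ξ)) = z k_E(ξ)` and
`γ_z(k_A(a)) = k_A(a)`. -/
def gauge (P : PimsnerAlgebra φ O) (z : Circle) : O →⋆ₐ[ℂ] O :=
  P.integrated (P.covariant.circle_smul z)

theorem gauge_kE (P : PimsnerAlgebra φ O) (z : Circle) (ξ : E) :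
    P.gauge z (P.kE ξ) = (z : ℂ) • P.kE ξ :=
  (P.universal O _ _ (P.covariant.circle_smul z)).choose_spec.1.1 ξ

theorem gauge_kA (P : PimsnerAlgebra φ O) (z : Circle) (a : A) :
    P.gauge z (P.kA a) = P.kA a :=
  (P.universal O _ _ (P.covariant.circle_smul z)).choose_spec.1.2 a

/-- `ω` is the action on the Pimsner algebra induced by an equivariant C⋆-correspondence:
`ω ∘ k_E = (k_E ⊗ id) ∘ λ` and `ω ∘ k_A = (k_A ⊗ id) ∘ α`. -/
structure IsInducedAction {C : Type u} [CStarAlgebra C] {G : CompactQuantumGroup C}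
    {α : QuantumAction G A} (P : PimsnerAlgebra φ O) (lam : ModuleAction α E)
    (ω : O →⋆ₐ[ℂ] MinTensor O C) : Prop where
  comp_kE : ∀ ξ, ω (P.kE ξ) = ExtTensor.mapAlg A C P.kE (lam.lam ξ)
  comp_kA : ∀ a, ω (P.kA a) = MinTensor.map P.kA (StarAlgHom.id ℂ C) (α.α a)

end PimsnerAlgebra

end Pimsner

end

/-! Both composites are unital `⋆`-homomorphisms from `O` to `MinTensor O C`, and such a map is
determined by its values on the generators `P.kE ξ` and `P.kA a`. This rigidity is
`PimsnerAlgebra.hom_ext`. Any unital `⋆`-homomorphism out of `O` turns the universal covariant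
representation into another covariant representation (`IsCovariant.comp_starAlgHom`), and the
universal property allows only one homomorphism inducing a given one. It remains to compare the two
sides on generators.

On generators the point is that gauge and quantum group act on different data. The element `ω (P.kE
ξ) = (k_E ⊗ id)(λ ξ)` has its first leg in the range of `k_E`, where `γ_z` is multiplication by `z`.
Hence `γ_z ⊗ id` multiplies it by `z`. In the other order `γ_z` produces the scalar `z` first, and
`ω` lets it pass by linearity. Likewise `ω (P.kA a) = (k_A ⊗ id)(α a)` has its first leg in the
range of `k_A`, which `γ_z` fixes, so both sides equal `ω (P.kA a)`.

The only analytic point is that `λ ξ` and `α a` lie in completed tensor products and need not be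
finite sums of elementary tensors. Thus "acting on the first leg" is made precise as two identities
of continuous maps on the whole completion, `(γ_z ⊗ id)(k_A ⊗ id) = k_A ⊗ id` and `(γ_z ⊗ id)(k_E ⊗
id) = z (k_E ⊗ id)`. By density these need checking only on the algebraic tensor product, and by
additivity only on elementary tensors, where they are the defining formulas of the gauge action. -/

/-- The composition of a covariant representation with a unital `⋆`-homomorphism is covariant. -/
theorem IsCovariant.comp_starAlgHom {A E : Type u} [CStarAlgebra A] [NormedAddCommGroup E]
    [NormedSpace ℂ E] [CompleteSpace E] [Module Aᵐᵒᵖ E] [HilbertModule A E]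
    {φ : A →⋆ₐ[ℂ] Adjointable A E} {B D : Type u} [CStarAlgebra B] [CStarAlgebra D]
    {t : E →ₗ[ℂ] B} {π : A →⋆ₐ[ℂ] B} (h : IsCovariant φ t π) (f : B →⋆ₐ[ℂ] D) :
    IsCovariant φ (f.toAlgHom.toLinearMap ∘ₗ t) (f.comp π) where
  inner ξ η := by
    change star (f (t ξ)) * f (t η) = f (π (hip A ξ η))
    rw [← h.inner, map_mul, map_star]
  left a ξ := by
    change f (t (φ a ξ)) = f (π a) * f (t ξ)
    rw [h.left, map_mul]
  covariant := by
    obtain ⟨ψ, hψ, hcov⟩ := h.covariant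
    -- The map for the new representation is `ψ_{f ∘ t} = f ∘ ψ_t`. Here `f` is regarded as a
    -- non-unital homomorphism because `ψ` is one: it need not send the identity operator to `1`.
    -- The condition on `a` in the covariance relation involves only `A` and `φ`, not the target
    -- algebra, so it passes unchanged from `π` to `f ∘ π`.
    refine ⟨(f : B →⋆ₙₐ[ℂ] D).comp ψ, fun ξ η => ?_, fun a ha => ?_⟩
    · change f (ψ (Adjointable.theta ξ η)) = f (t ξ) * star (f (t η))
      rw [hψ, map_mul, map_star]
    · change f (ψ (φ a)) = f (π a)
      rw [hcov a ha]

/-- Unital `⋆`-homomorphisms on the Pimsner algebra that agree on its generators are equal. -/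
theorem PimsnerAlgebra.hom_ext {A E : Type u} [CStarAlgebra A] [NormedAddCommGroup E]
    [NormedSpace ℂ E] [CompleteSpace E] [Module Aᵐᵒᵖ E] [HilbertModule A E]
    {φ : A →⋆ₐ[ℂ] Adjointable A E} {O B : Type u} [CStarAlgebra O] [CStarAlgebra B]
    (P : PimsnerAlgebra φ O) {f g : O →⋆ₐ[ℂ] B} (hE : ∀ ξ, f (P.kE ξ) = g (P.kE ξ))
    (hA : ∀ a, f (P.kA a) = g (P.kA a)) : f = g :=
  -- Uniqueness is invoked for the covariant representation `(g ∘ k_E, g ∘ k_A)`. The map `g`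
  -- induces it by definition, and `f` induces it by the agreement on generators.
  (P.universal B _ _ (P.covariant.comp_starAlgHom g)).unique ⟨hE, hA⟩
    ⟨fun _ => rfl, fun _ => rfl⟩

/-- The homomorphism `map f g` has `mapL f g` as its underlying function, so the formula on the
algebraic tensor product carries over definitionally. In this form it lets composites of tensor maps
be computed by successive rewriting. -/
theorem MinTensor.map_apply_ι {A B A' B' : Type u} [CStarAlgebra A] [CStarAlgebra B]
    [CStarAlgebra A'] [CStarAlgebra B'] (f : A →⋆ₐ[ℂ] A') (g : B →⋆ₐ[ℂ] B') (x : A ⊗[ℂ] B) :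
    MinTensor.map f g (MinTensor.ι A B x) =
      MinTensor.ι A' B' (Algebra.TensorProduct.map f.toAlgHom g.toAlgHom x) :=
  MinTensor.mapL_ι f g x

/-- Continuity comes from the construction of `map f g` as a continuous extension. It supplies the
closedness needed in the density arguments below. -/
theorem MinTensor.continuous_map {A B A' B' : Type u} [CStarAlgebra A] [CStarAlgebra B]
    [CStarAlgebra A'] [CStarAlgebra B'] (f : A →⋆ₐ[ℂ] A') (g : B →⋆ₐ[ℂ] B') :
    Continuous (MinTensor.map f g) :=
  (MinTensor.mapL f g).continuous

/-- `(γ_z ⊗ id) ∘ (k_A ⊗ id) = k_A ⊗ id`. -/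
theorem PimsnerAlgebra.map_gauge_map_kA {A E : Type u} [CStarAlgebra A] [NormedAddCommGroup E]
    [NormedSpace ℂ E] [CompleteSpace E] [Module Aᵐᵒᵖ E] [HilbertModule A E]
    {φ : A →⋆ₐ[ℂ] Adjointable A E} {O C : Type u} [CStarAlgebra O] [CStarAlgebra C]
    (P : PimsnerAlgebra φ O) (z : Circle) (x : MinTensor A C) :
    MinTensor.map (P.gauge z) (StarAlgHom.id ℂ C) (MinTensor.map P.kA (StarAlgHom.id ℂ C) x) =
      MinTensor.map P.kA (StarAlgHom.id ℂ C) x := by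
  -- Both sides are continuous in `x`, so the set where they agree is closed and it suffices to take
  -- `x` in the dense image of the algebraic tensor product.
  refine MinTensor.induction (isClosed_eq ((MinTensor.continuous_map _ _).comp
    (MinTensor.continuous_map _ _)) (MinTensor.continuous_map _ _)) (fun y => ?_) x
  rw [Function.comp_apply, MinTensor.map_apply_ι, MinTensor.map_apply_ι]
  -- Both sides are now images under `MinTensor.ι O C`, so an equality in the algebraic tensor
  -- product `O ⊗[ℂ] C` is enough. No injectivity of `ι` is involved.
  congr 1
  induction y with
  | zero => simp
  | add x y hx hy => rw [map_add, map_add, hx, hy]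
  | tmul a c =>
    -- On an elementary tensor the second leg is untouched by the identity maps, and the claim is
    -- that the gauge action fixes the coefficient algebra.
    change P.gauge z (P.kA a) ⊗ₜ[ℂ] c = P.kA a ⊗ₜ[ℂ] c
    rw [P.gauge_kA]

/-- `(γ_z ⊗ id) ∘ (k_E ⊗ id) = z (k_E ⊗ id)`. -/
theorem PimsnerAlgebra.map_gauge_mapAlg_kE {A E : Type u} [CStarAlgebra A] [NormedAddCommGroup E]
    [NormedSpace ℂ E] [CompleteSpace E] [Module Aᵐᵒᵖ E] [HilbertModule A E]
    {φ : A →⋆ₐ[ℂ] Adjointable A E} {O C : Type u} [CStarAlgebra O] [CStarAlgebra C]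
    (P : PimsnerAlgebra φ O) (z : Circle) (v : ExtTensor A E C) :
    MinTensor.map (P.gauge z) (StarAlgHom.id ℂ C) (ExtTensor.mapAlg A C P.kE v) =
      (z : ℂ) • ExtTensor.mapAlg A C P.kE v := by
  -- The same density argument, now on the exterior tensor product: the right side is continuous as
  -- a scalar multiple of the continuous linear map `k_E ⊗ id`.
  refine (ExtTensor.denseRange_ι (A := A)).induction_on v
    (isClosed_eq ((MinTensor.continuous_map _ _).comp (ExtTensor.mapAlg A C P.kE).continuous)
      ((z : ℂ) • ExtTensor.mapAlg A C P.kE).continuous) fun w => ?_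
  -- The relation `k_E(ξ)⋆ k_E(η) = k_A(⟨ξ, η⟩)` is what makes `k_E ⊗ id` bounded for the norm of
  -- the exterior tensor product, and hence makes the extension `mapAlg` agree with it on algebraic
  -- tensors. Reversing `map_smul` then moves the scalar `z` inside `MinTensor.ι O C`, so that both
  -- sides are images of algebraic tensors.
  rw [ExtTensor.mapAlg_ι P.covariant.inner, MinTensor.map_apply_ι, ← map_smul]
  congr 1
  induction w with
  | zero => simp
  | add x y hx hy => rw [map_add, map_add, hx, hy, smul_add]
  | tmul ξ c =>
    change P.gauge z (P.kE ξ) ⊗ₜ[ℂ] c = (z : ℂ) • (P.kE ξ ⊗ₜ[ℂ] c)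
    -- The scalar produced by the gauge action sits in the first leg, and the scalar on the right is
    -- absorbed into that same leg.
    rw [P.gauge_kE, TensorProduct.smul_tmul']

theorem mainTheorem11 {C A E O : Type u} [CStarAlgebra C] [CStarAlgebra A] [CStarAlgebra O]
    [NormedAddCommGroup E] [NormedSpace ℂ E] [CompleteSpace E] [Module Aᵐᵒᵖ E]
    [HilbertModule A E] [Module.Finite Aᵐᵒᵖ E] [Module.Projective Aᵐᵒᵖ E]
    (G : CompactQuantumGroup C) (α : QuantumAction G A) (lam : ModuleAction α E)
    (φ : A →⋆ₐ[ℂ] Adjointable A E) (hφ : IsEquivariant lam φ) (P : PimsnerAlgebra φ O)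
    (ω : O →⋆ₐ[ℂ] MinTensor O C) (hω : P.IsInducedAction lam ω) (z : Circle) :
    (MinTensor.map (P.gauge z) (StarAlgHom.id ℂ C)).comp ω = ω.comp (P.gauge z) := by
  refine P.hom_ext (fun ξ => ?_) fun a => ?_
  -- On the right the factor `z` comes from the gauge action and leaves `ω` by linearity. On the
  -- left it comes from applying `γ_z ⊗ id` to `(k_E ⊗ id)(λ ξ)`. Both sides become `z (k_E ⊗ id)(λ
  -- ξ)`.
  · rw [StarAlgHom.comp_apply, StarAlgHom.comp_apply, P.gauge_kE, map_smul, hω.comp_kE,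
      P.map_gauge_mapAlg_kE]
  -- Both sides reduce to `(k_A ⊗ id)(α a)`, since neither `γ_z` before `ω` nor `γ_z ⊗ id` after it
  -- changes anything on the coefficient algebra.
  · rw [StarAlgHom.comp_apply, StarAlgHom.comp_apply, P.gauge_kA, hω.comp_kA,
      P.map_gauge_map_kA]
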